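/- Let $n\ge 1$, let $P_T$ be a probability measure on an arbitrary measurable space $\mathcal T$, and let $P_{Z|T}$, $P_{Y|T}$ be Markov kernels from $\mathcal T$ to $\mathbb R^n$ such that for every $t\in\mathcal T$: $P_{Y|T=t}=\mathcal N(0,I_n)$, $P_{Z|T=t}\ll\mathcal N(0,I_n)$, and $P_{Z|T=t}$ has finite second moment. Define the conditional Wasserstein distance $$W_2(P_{Z|T},P_{Y|T}\,|\,P_T)=\inf_P\big(\mathbb E_P\|Z-Y\|^2\big)^{1/2}\in[0,\infty],$$ where $\|\cdot\|$ is the Euclidean norm and the infimum is over all joint laws $P=P_T\cdot P_{\bar Z,\bar Y|T}$ of $(T,Z,Y)$, with $P_{\bar Z,\bar Y|T}$ a Markov kernel from $\mathcal T$ to $\mathbb R^n\times\mathbb R^n$ satisfying $P_{\bar Z|T}=P_{Z|T}$ and $P_{\bar Y|T}=P_{Y|T}$. Let $h(Z|T)=\int h(Z|T=t)\,dP_T(t)$, where $h(Z|T=t)=-\int_{\mathbb R^n} f_t\ln f_t\,dx\in[-\infty,\infty)$ is the differential entropy of $P_{Z|T=t}$, which has density $f_t$, and let $\mathbb E\|Z\|^2=\int\!\int\|z\|^2\,dP_{Z|T=t}(z)\,dP_T(t)\in[0,\infty]$.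 Put $e^{-\infty}=0$. Then $$W_2^2(P_{Z|T},P_{Y|T}\,|\,P_T)\;\le\;\mathbb E\|Z\|^2+n-2n\sqrt{\frac{1}{2\pi e}\,e^{\frac 2n h(Z|T)}},$$ provided the right-hand side is not of the form $\infty-\infty$, that is, unless $\mathbb E\|Z\|^2=\infty$ and $h(Z|T)=+\infty$. (If the positive and the negative part of $t\mapsto h(Z|T=t)$ both have infinite integral, which can only happen when $\mathbb E\|Z\|^2=\infty$, put $h(Z|T)=-\infty$; the right-hand side is then $+\infty$.) -/

import Mathlib

open MeasureTheory ProbabilityTheory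
open scoped ENNReal

noncomputable section

/-- Moment condition defining the class of probability measures of order `p`: the `p`-th moment of
the distance to some point is finite. -/
def HasFiniteMoment {Ω : Type*} [MetricSpace Ω] [MeasurableSpace Ω] (p : ℝ) (μ : Measure Ω) :
    Prop :=
  ∃ ω₀ : Ω, ∫⁻ ω, edist ω ω₀ ^ p ∂μ < ⊤

/-- Joint laws of `(T, Z, Y)` of the form `P_T · P_{Z,Y|T}`, where the two conditional marginals of
`P_{Z,Y|T}` are the prescribed conditional laws `P_{Z|T}` and `P_{Y|T}`. -/
def condCouplings {𝒯 Ω : Type*} [MeasurableSpace 𝒯] [MeasurableSpace Ω]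
    (PT : Measure 𝒯) (PZ PY : Kernel 𝒯 Ω) : Set (Measure (𝒯 × Ω × Ω)) :=
  {P | ∃ κ : Kernel 𝒯 (Ω × Ω), IsMarkovKernel κ ∧ κ.fst = PZ ∧ κ.snd = PY ∧ P = PT ⊗ₘ κ}

/-- Conditional Wasserstein distance of order `p`, with values in `[0, ∞]`. -/
def condWasserstein {𝒯 Ω : Type*} [MeasurableSpace 𝒯] [MetricSpace Ω] [MeasurableSpace Ω]
    (p : ℝ) (PT : Measure 𝒯) (PZ PY : Kernel 𝒯 Ω) : ℝ≥0∞ :=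
  ⨅ P ∈ condCouplings PT PZ PY, (∫⁻ x, edist x.2.1 x.2.2 ^ p ∂P) ^ (1 / p)

/-- Extended-real-valued Lebesgue integral: integral of the positive part minus integral of the
negative part. -/
def extIntegral {α : Type*} [MeasurableSpace α] (μ : Measure α) (f : α → EReal) : EReal :=
  ((∫⁻ x, (f x).toENNReal ∂μ : ℝ≥0∞) : EReal) - ((∫⁻ x, (-f x).toENNReal ∂μ : ℝ≥0∞) : EReal)

/-- Differential entropy `- ∫ f log f` (natural logarithm) of a law on `ℝⁿ` that is absolutely
continuous with respect to Lebesgue measure, with density `f`. -/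
def diffEntropy {n : ℕ} (μ : Measure (EuclideanSpace ℝ (Fin n))) : EReal :=
  extIntegral volume fun x => ((Real.negMulLog (μ.rnDeriv volume x).toReal : ℝ) : EReal)

/-- Conditional differential entropy `h(Z|T) = ∫ h(Z|T=t) dP_T(t)`. -/
def condDiffEntropy {𝒯 : Type*} [MeasurableSpace 𝒯] {n : ℕ} (PT : Measure 𝒯)
    (PZ : Kernel 𝒯 (EuclideanSpace ℝ (Fin n))) : EReal :=
  extIntegral PT fun t => diffEntropy (PZ t)

/-- `E ‖Z‖²` for `T ∼ P_T` and `Z` with conditional law `P_{Z|T}` given `T`. -/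
def secondMoment {𝒯 : Type*} [MeasurableSpace 𝒯] {n : ℕ} (PT : Measure 𝒯)
    (PZ : Kernel 𝒯 (EuclideanSpace ℝ (Fin n))) : ℝ≥0∞ :=
  ∫⁻ z, ‖z‖ₑ ^ 2 ∂(PT.bind PZ)

end

/-!
The conditional laws `P_{Z|T=t}` are transported to the standard Gaussian law by the
Knothe–Rosenblatt map `S_t`, a triangular map whose `k`-th coordinate is the monotone
rearrangement `Φ⁻¹ ∘ F` of the law of `Z_k` given `Z_1, …, Z_{k-1}` and `T = t`. Since `S_t(z)` is
built from disintegration kernels and distribution functions, it is jointly measurable in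
`(t, z)`, so that `(Z, S_T(Z))` is an admissible coupling, of cost `E‖Z‖² + n - 2 E⟨Z, S_T(Z)⟩`. It
remains to show `E⟨Z, S_T(Z)⟩ ≥ n e^{h(Z|T)/n} / √(2πe)`.

On the line, let `μ` have distribution function `F` and density `f`, let `φ` be the Gaussian
density and `S = Φ⁻¹ ∘ F`. Fubini's theorem gives
`E[Z S(Z)] = ∫ E[S(Z) 1{Z > z}] dz = ∫_{0 < F < 1} φ(S(z)) dz ≥ E[φ(S(Z)) / f(Z)]`,
because `E[Y 1{Y > a}] = φ(a)` for a standard Gaussian `Y`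
(`integral_mul_monotoneMap`, `lintegral_ratio_le_integral_mul_monotoneMap`). The ratio `φ(S) / f`
plays the role of the derivative of `S⁻¹`, but neither `S` nor `f` has to be regular. Summing over
the coordinates, `E⟨Z, S(Z)⟩` dominates the mean of the sum `∑ D_k` of the corresponding
conditional ratios, whose product is `φ(S(Z)) / f(Z)` with the `n`-dimensional densities.

For every real `c`, `D ≥ e^c (1 - c + log D)`; hence `∑ D_k` is at least
`e^c (n (1 - c) + log φ(S(Z)) - log f(Z))`. These affine bounds, unlike the inequality between the arithmetic and the
geometric mean, are additive in the dimension and pass through integrals; they are recorded in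
`IsEntropicTransport` and carried through the induction on the dimension in
`exists_isEntropicTransport`. Integration over `z`, with `E log φ(Y) = -n/2 log(2πe)`, and over
`t` gives `E⟨Z, S_T(Z)⟩ ≥ e^c (n (1 - c) + h(Z|T) - n/2 log(2πe))`
(`IsEntropicTransport.exp_mul_le_integral`), and the best choice `c = h(Z|T)/n - log(2πe)/2` gives
the claim. If `h(Z|T) = -∞`, only `E⟨Z, S_T(Z)⟩ ≥ 0` is needed. A finite `E‖Z‖²` excludes
`h(Z|T) = ∞` by Gibbs' inequality (`entropyPos_le`), and an infinite one makes the right-hand side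
infinite.
-/

open Set Filter Topology

universe u

/-! ### Distribution functions on the line -/

lemma continuous_cdf (μ : Measure ℝ) [IsProbabilityMeasure μ] [NullSingletonClass μ] :
    Continuous (cdf μ) := by
  refine continuous_iff_continuousAt.2 fun x => ?_
  rw [(cdf μ).mono.continuousAt_iff_leftLim_eq_rightLim, StieltjesFunction.rightLim_eq]
  have h := (cdf μ).measure_singleton x
  rw [measure_cdf, measure_singleton] at h
  have h1 : (cdf μ) x - Function.leftLim (cdf μ) x ≤ 0 := ENNReal.ofReal_eq_zero.1 h.symm
  have h2 := (cdf μ).mono.leftLim_le (le_refl x)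
  linarith

/-- A continuous distribution function takes every value strictly between `0` and `1`. -/
lemma exists_cdf_eq (μ : Measure ℝ) [IsProbabilityMeasure μ] [NullSingletonClass μ] {u : ℝ}
    (hu : u ∈ Ioo 0 1) : ∃ x, cdf μ x = u := by
  obtain ⟨a, ha⟩ := ((tendsto_cdf_atBot μ).eventually (gt_mem_nhds hu.1)).exists
  obtain ⟨b, hb⟩ := ((tendsto_cdf_atTop μ).eventually (lt_mem_nhds hu.2)).exists
  exact mem_range_of_exists_le_of_exists_ge (continuous_cdf μ) ⟨a, ha.le⟩ ⟨b, hb.le⟩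

/-- The probability integral transform: if `Z` has a continuous distribution function `F`, then
`F(Z)` is uniformly distributed on `[0, 1]`. -/
lemma measure_cdf_le (μ : Measure ℝ) [IsProbabilityMeasure μ] [NullSingletonClass μ] {u : ℝ}
    (hu : u ∈ Ioo 0 1) : μ {z | cdf μ z ≤ u} = ENNReal.ofReal u := by
  set A := {z | cdf μ z ≤ u} with hA
  obtain ⟨y, hy⟩ := exists_cdf_eq μ hu
  obtain ⟨b, hb⟩ := ((tendsto_cdf_atTop μ).eventually (lt_mem_nhds hu.2)).exists
  have hyA : y ∈ A := hy.le
  have hbd : BddAbove A := ⟨b, fun z hz => by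
    by_contra hcon
    exact absurd (((cdf μ).mono (not_le.1 hcon).le).trans hz) (not_le.2 hb)⟩
  have hclosed : IsClosed A := isClosed_le (continuous_cdf μ) continuous_const
  have hm : sSup A ∈ A := hclosed.csSup_mem ⟨y, hyA⟩ hbd
  have hAeq : A = Iic (sSup A) :=
    Subset.antisymm (fun z hz => le_csSup hbd hz) fun z hz => ((cdf μ).mono hz).trans hm
  have hval : cdf μ (sSup A) = u :=
    le_antisymm hm (hy ▸ (cdf μ).mono (le_csSup hbd hyA))
  rw [hAeq, ← ofReal_cdf, hval]

lemma ae_cdf_mem_Ioo (μ : Measure ℝ) [IsProbabilityMeasure μ] [NullSingletonClass μ] :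
    ∀ᵐ z ∂μ, cdf μ z ∈ Ioo (0 : ℝ) 1 := by
  have hmeas : Measurable (cdf μ) := (cdf μ).mono.measurable
  have hreal : ∀ u ∈ Ioo (0 : ℝ) 1, μ.real {z | cdf μ z ≤ u} = u := fun u hu => by
    rw [measureReal_def, measure_cdf_le μ hu, ENNReal.toReal_ofReal hu.1.le]
  -- If `{F ≤ 0}` had mass `p > 0`, then `{F ≤ p / 2}` would have mass at least `p`.
  -- Similarly at `1`.
  have h0 : μ.real {z | cdf μ z ≤ 0} = 0 := by
    by_contra hne
    have hp : 0 < μ.real {z | cdf μ z ≤ 0} := lt_of_le_of_ne measureReal_nonneg (Ne.symm hne)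
    have hp1 : μ.real {z | cdf μ z ≤ 0} ≤ 1 := measureReal_le_one
    set p := μ.real {z | cdf μ z ≤ 0}
    have : p ≤ p / 2 := by
      rw [← hreal (p / 2) ⟨by linarith, by linarith⟩]
      exact measureReal_mono fun z (hz : cdf μ z ≤ 0) => (by
        change cdf μ z ≤ p / 2
        linarith)
    linarith
  have h1 : μ.real {z | 1 ≤ cdf μ z} = 0 := by
    by_contra hne
    have hp : 0 < μ.real {z | 1 ≤ cdf μ z} := lt_of_le_of_ne measureReal_nonneg (Ne.symm hne)
    have hp1 : μ.real {z | 1 ≤ cdf μ z} ≤ 1 := measureReal_le_one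
    set p := μ.real {z | 1 ≤ cdf μ z}
    have hr := hreal (1 - p / 2) ⟨by linarith, by linarith⟩
    have hdisj : Disjoint {z | 1 ≤ cdf μ z} {z | cdf μ z ≤ 1 - p / 2} := by
      rw [Set.disjoint_left]
      intro z (hz : 1 ≤ cdf μ z) (hz' : cdf μ z ≤ 1 - p / 2)
      linarith
    have hun := measureReal_union (μ := μ) hdisj (measurableSet_le hmeas measurable_const)
    have hle : μ.real ({z | 1 ≤ cdf μ z} ∪ {z | cdf μ z ≤ 1 - p / 2}) ≤ 1 := measureReal_le_one
    rw [hun, hr] at hle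
    change p + (1 - p / 2) ≤ 1 at hle
    linarith
  have h0' : ∀ᵐ z ∂μ, ¬ cdf μ z ≤ 0 := by
    rw [ae_iff]; simpa using (measureReal_eq_zero_iff).1 h0
  have h1' : ∀ᵐ z ∂μ, ¬ 1 ≤ cdf μ z := by
    rw [ae_iff]; simpa using (measureReal_eq_zero_iff).1 h1
  filter_upwards [h0', h1'] with z hz hz'
  exact ⟨not_le.1 hz, not_le.1 hz'⟩

/-- Level sets of a continuous distribution function are null, so `{F ≤ F(z)}` and `(-∞, z]` differ
by a null set. -/
lemma setOf_cdf_le_ae_eq (μ : Measure ℝ) [IsProbabilityMeasure μ] [NullSingletonClass μ] {z : ℝ}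
    (hz : cdf μ z ∈ Ioo (0 : ℝ) 1) : ({w | cdf μ w ≤ cdf μ z} : Set ℝ) =ᵐ[μ] Iic z := by
  have hsub : Iic z ⊆ {w | cdf μ w ≤ cdf μ z} := fun w hw => (cdf μ).mono hw
  have hle : μ {w | cdf μ w ≤ cdf μ z} ≤ μ (Iic z) := by
    rw [measure_cdf_le μ hz, ← ofReal_cdf]
  exact (ae_eq_of_subset_of_measure_ge hsub hle measurableSet_Iic.nullMeasurableSet
    (measure_ne_top _ _)).symm

/-! ### The standard Gaussian law on the line -/

instance : NullSingletonClass (gaussianReal 0 1) := nullSingletonClass_gaussianReal one_ne_zero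

lemma cdf_gaussianReal_mem_Ioo (y : ℝ) : cdf (gaussianReal 0 1) y ∈ Ioo (0 : ℝ) 1 := by
  have hac := gaussianReal_absolutelyContinuous' 0 (one_ne_zero (α := NNReal))
  have h1 : gaussianReal 0 1 (Iic y) ≠ 0 := fun h => by simpa using hac h
  have h2 : gaussianReal 0 1 (Iic y)ᶜ ≠ 0 := fun h => by simpa using hac h
  constructor
  · rw [cdf_eq_real]
    exact measureReal_nonneg.lt_of_ne fun h => h1 ((measureReal_eq_zero_iff).1 h.symm)
  · rw [cdf_eq_real]
    have h3 := measureReal_add_measureReal_compl (μ := gaussianReal 0 1)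
      (measurableSet_Iic (a := y))
    have h4 : 0 < (gaussianReal 0 1).real (Iic y)ᶜ :=
      measureReal_nonneg.lt_of_ne fun h => h2 ((measureReal_eq_zero_iff).1 h.symm)
    rw [probReal_univ] at h3
    linarith

/-- The quantile function `Φ⁻¹` of the standard Gaussian law, extended by `0` outside `(0, 1)`. -/
noncomputable def gaussianQuantile (u : ℝ) : ℝ :=
  open Classical in if u ∈ Ioo (0 : ℝ) 1 then sInf {y | u ≤ cdf (gaussianReal 0 1) y} else 0

lemma gaussianQuantile_le_iff {u : ℝ} (hu : u ∈ Ioo (0 : ℝ) 1) (y : ℝ) :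
    gaussianQuantile u ≤ y ↔ u ≤ cdf (gaussianReal 0 1) y := by
  rw [gaussianQuantile, if_pos hu]
  obtain ⟨x, hx⟩ := exists_cdf_eq (gaussianReal 0 1) hu
  obtain ⟨a, ha⟩ :=
    ((tendsto_cdf_atBot (gaussianReal 0 1)).eventually (gt_mem_nhds hu.1)).exists
  have hbd : BddBelow {y | u ≤ cdf (gaussianReal 0 1) y} := ⟨a, fun z hz => by
    by_contra hcon
    exact absurd (le_trans hz ((cdf _).mono (not_le.1 hcon).le)) (not_le.2 ha)⟩
  have hmem := (isClosed_le continuous_const (continuous_cdf (gaussianReal 0 1))).csInf_mem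
    ⟨x, hx.ge⟩ hbd
  exact ⟨fun h => le_trans hmem ((cdf _).mono h), fun h => csInf_le hbd h⟩

lemma cdf_gaussianQuantile {u : ℝ} (hu : u ∈ Ioo (0 : ℝ) 1) :
    cdf (gaussianReal 0 1) (gaussianQuantile u) = u := by
  obtain ⟨x, hx⟩ := exists_cdf_eq (gaussianReal 0 1) hu
  exact le_antisymm (((cdf _).mono ((gaussianQuantile_le_iff hu x).2 hx.ge)).trans_eq hx)
    ((gaussianQuantile_le_iff hu _).1 le_rfl)

lemma measurable_gaussianQuantile : Measurable gaussianQuantile := by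
  refine measurable_of_Iic fun y => ?_
  have : gaussianQuantile ⁻¹' Iic y = (Ioo 0 1 ∩ Iic (cdf (gaussianReal 0 1) y)) ∪
      ((Ioo 0 1)ᶜ ∩ {_u | (0 : ℝ) ≤ y}) := by
    ext u
    by_cases hu : u ∈ Ioo (0 : ℝ) 1
    · simp only [mem_preimage, mem_Iic, gaussianQuantile_le_iff hu, mem_union, mem_inter_iff, hu,
        true_and, mem_compl_iff, not_true_eq_false, false_and, or_false]
    · simp [gaussianQuantile, hu]
  rw [this]
  exact (measurableSet_Ioo.inter measurableSet_Iic).union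
    (measurableSet_Ioo.compl.inter (MeasurableSet.const _))

lemma gaussianPDFReal_zero_one (x : ℝ) :
    gaussianPDFReal 0 1 x = (√(2 * Real.pi))⁻¹ * Real.exp (-x ^ 2 / 2) := by
  simp [gaussianPDFReal]

lemma integrable_id_gaussianReal : Integrable (fun x : ℝ => x) (gaussianReal 0 1) :=
  (memLp_id_gaussianReal 1).integrable le_rfl

/-- `E[Y 1{Y > a}] = φ(a)` for a standard Gaussian `Y` with density `φ`. -/
lemma setIntegral_Ioi_gaussianReal (a : ℝ) :
    ∫ y in Ioi a, y ∂(gaussianReal 0 1) = gaussianPDFReal 0 1 a := by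
  have hint : Integrable (fun x : ℝ => gaussianPDFReal 0 1 x * x) := by
    have h := integrable_id_gaussianReal
    rw [gaussianReal_of_var_ne_zero _ one_ne_zero, integrable_withDensity_iff_integrable_smul'
      (measurable_gaussianPDF 0 1) (ae_of_all _ fun x => gaussianPDF_lt_top)] at h
    simpa [toReal_gaussianPDF] using h
  have h1 : ∫ y in Ioi a, y ∂(gaussianReal 0 1) = ∫ y in Ioi a, gaussianPDFReal 0 1 y * y := by
    rw [← integral_indicator measurableSet_Ioi,
      integral_gaussianReal_eq_integral_smul one_ne_zero, ← integral_indicator measurableSet_Ioi]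
    congr 1 with y
    by_cases hy : y ∈ Ioi a <;> simp [hy]
  have hderiv : ∀ x : ℝ, HasDerivAt (fun x => -gaussianPDFReal 0 1 x)
      (gaussianPDFReal 0 1 x * x) x := fun x => by
    simp_rw [gaussianPDFReal_zero_one]
    have h : HasDerivAt (fun x : ℝ => -x ^ 2 / 2) (-x) x := 
      (((hasDerivAt_pow 2 x).fun_neg).div_const 2).congr_deriv (by push_cast; ring)
    exact ((h.exp).const_mul (√(2 * Real.pi))⁻¹).fun_neg.congr_deriv (by ring)
  have hlim : Tendsto (fun x => -gaussianPDFReal 0 1 x) atTop (𝓝 0) := by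
    simp_rw [gaussianPDFReal_zero_one]
    have h : Tendsto (fun x : ℝ => -x ^ 2 / 2) atTop atBot := by
      have := (tendsto_pow_atTop (α := ℝ) two_ne_zero).atTop_div_const (r := 2) two_pos
      have := tendsto_neg_atTop_atBot.comp this
      refine this.congr fun x => ?_
      simp [neg_div]
    simpa using ((Real.tendsto_exp_atBot.comp h).const_mul (√(2 * Real.pi))⁻¹).neg
  rw [h1, integral_Ioi_of_hasDerivAt_of_tendsto' (fun x _ => hderiv x) hint.integrableOn hlim]
  simp

/-! ### Monotone transport to the Gaussian on the line -/

/-- The increasing map `Φ⁻¹ ∘ F` that transports a law `μ` with continuous distribution function `F`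
to the standard Gaussian law. -/
noncomputable def monotoneMap (μ : Measure ℝ) (z : ℝ) : ℝ := gaussianQuantile (cdf μ z)

lemma measurable_monotoneMap (μ : Measure ℝ) : Measurable (monotoneMap μ) :=
  measurable_gaussianQuantile.comp (cdf μ).mono.measurable

section

variable (μ : Measure ℝ) [IsProbabilityMeasure μ] [NullSingletonClass μ]

lemma map_monotoneMap : μ.map (monotoneMap μ) = gaussianReal 0 1 := by
  have := Measure.isProbabilityMeasure_map (μ := μ) (measurable_monotoneMap μ).aemeasurable
  refine Measure.eq_of_cdf _ _ (StieltjesFunction.ext fun y => ?_)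
  have hy := cdf_gaussianReal_mem_Ioo y
  rw [cdf_eq_real, measureReal_def, Measure.map_apply (measurable_monotoneMap μ) measurableSet_Iic]
  have : (monotoneMap μ ⁻¹' Iic y : Set ℝ) =ᵐ[μ] {z | cdf μ z ≤ cdf (gaussianReal 0 1) y} := by
    filter_upwards [ae_cdf_mem_Ioo μ] with z hz
    exact propext (gaussianQuantile_le_iff hz y)
  rw [measure_congr this, measure_cdf_le μ hy, ENNReal.toReal_ofReal hy.1.le]

lemma integrable_monotoneMap : Integrable (monotoneMap μ) μ := by
  have h := integrable_id_gaussianReal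
  rw [← map_monotoneMap μ] at h
  exact h.comp_measurable (measurable_monotoneMap μ)

lemma integral_monotoneMap : ∫ z, monotoneMap μ z ∂μ = 0 := by
  have h := integral_map (μ := μ) (measurable_monotoneMap μ).aemeasurable
    (f := fun x : ℝ => x) (by fun_prop)
  rw [← h, map_monotoneMap, integral_id_gaussianReal]

open Classical in
/-- Tail integrals of the transport map are values of the Gaussian density: they are
`E[Y 1{Y > a}] = φ(a)` read in the variable `Y = Φ⁻¹(F(Z))`. -/
lemma setIntegral_Ioi_monotoneMap (z : ℝ) :
    ∫ w in Ioi z, monotoneMap μ w ∂μ =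
      if cdf μ z ∈ Ioo (0 : ℝ) 1 then gaussianPDFReal 0 1 (monotoneMap μ z) else 0 := by
  split_ifs with hz
  · have hset : (Ioi z : Set ℝ) =ᵐ[μ] monotoneMap μ ⁻¹' Ioi (monotoneMap μ z) := by
      filter_upwards [ae_cdf_mem_Ioo μ, setOf_cdf_le_ae_eq μ hz] with w hw hw'
      have h1 : monotoneMap μ w ≤ monotoneMap μ z ↔ cdf μ w ≤ cdf μ z := by
        rw [monotoneMap, gaussianQuantile_le_iff hw, monotoneMap, cdf_gaussianQuantile hz]
      have h2 : cdf μ w ≤ cdf μ z ↔ w ≤ z := iff_of_eq hw'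
      refine propext ?_
      change z < w ↔ monotoneMap μ z < monotoneMap μ w
      rw [← not_le, ← not_le, h1, h2]
    rw [setIntegral_congr_set hset, ← setIntegral_Ioi_gaussianReal, ← map_monotoneMap μ,
      setIntegral_map measurableSet_Ioi (by fun_prop) (measurable_monotoneMap μ).aemeasurable]
  · -- Almost all or almost none of the mass lies above `z`, and `S(Z)` is centred.
    have hz' : cdf μ z = 0 ∨ cdf μ z = 1 := by
      by_contra! hcon
      exact hz ⟨(cdf_nonneg μ z).lt_of_ne hcon.1.symm, (cdf_le_one μ z).lt_of_ne hcon.2⟩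
    rcases hz' with h | h
    · have h0 : μ (Iic z) = 0 := by rw [← ofReal_cdf, h, ENNReal.ofReal_zero]
      have hset : (Ioi z : Set ℝ) =ᵐ[μ] univ := by
        rw [ae_eq_univ, compl_Ioi, h0]
      rw [setIntegral_congr_set hset, setIntegral_univ, integral_monotoneMap]
    · have h0 : μ (Ioi z) = 0 := by
        rw [← compl_Iic, prob_compl_eq_zero_iff measurableSet_Iic, ← ofReal_cdf, h,
          ENNReal.ofReal_one]
      exact setIntegral_measure_zero _ h0

lemma integrable_mul_monotoneMap (h2 : MemLp (fun z : ℝ => z) 2 μ) :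
    Integrable (fun z => z * monotoneMap μ z) μ := by
  have h := memLp_id_gaussianReal (μ := 0) (v := 1) 2
  rw [← map_monotoneMap μ] at h
  have h' : MemLp (monotoneMap μ) 2 μ :=
    (memLp_map_measure_iff (by fun_prop) (measurable_monotoneMap μ).aemeasurable).1 h
  exact h2.integrable_mul h'

end

/-- The kernel `1{z < w} - 1{z < 0}`, whose integral over `z` is `w`. -/
noncomputable def layerKernel (w z : ℝ) : ℝ :=
  (Ico 0 w).indicator 1 z - (Ico w 0).indicator 1 z

lemma layerKernel_eq (w z : ℝ) :
    layerKernel w z = (Ioi z).indicator 1 w - (Iio (0 : ℝ)).indicator 1 z := by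
  rcases lt_or_ge z w with h1 | h1 <;> rcases lt_or_ge z 0 with h2 | h2 <;>
    simp [layerKernel, indicator, not_le.2, not_lt.2, h1, h2]

lemma integral_layerKernel (w : ℝ) : ∫ z, layerKernel w z = w := by
  unfold layerKernel
  rw [integral_sub, integral_indicator_one measurableSet_Ico,
    integral_indicator_one measurableSet_Ico, Real.volume_real_Ico, Real.volume_real_Ico]
  · rcases le_total 0 w with h | h <;> simp [h]
  all_goals exact (integrable_indicator_iff measurableSet_Ico).2 (by simp [Pi.one_def])

lemma integrable_layerKernel (w : ℝ) : Integrable (layerKernel w) := by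
  unfold layerKernel
  refine Integrable.sub ?_ ?_
  all_goals exact (integrable_indicator_iff measurableSet_Ico).2 (by simp [Pi.one_def])

lemma abs_layerKernel (w z : ℝ) : |layerKernel w z| = SignType.sign w * layerKernel w z := by
  rcases lt_trichotomy w 0 with h | rfl | h
  · have : Ico 0 w = ∅ := Ico_eq_empty (by simpa using h.le)
    simp only [layerKernel, this, indicator_empty, zero_sub, abs_neg, sign_neg h]
    rw [abs_of_nonneg (indicator_nonneg (by simp) _)]
    simp
  · simp [layerKernel]
  · have : Ico w 0 = ∅ := Ico_eq_empty (by simpa using h.le)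
    simp only [layerKernel, this, indicator_empty, sub_zero, sign_pos h]
    rw [abs_of_nonneg (indicator_nonneg (by simp) _)]
    simp

lemma integral_abs_layerKernel (w : ℝ) : ∫ z, |layerKernel w z| = |w| := by
  simp_rw [abs_layerKernel]
  rw [integral_const_mul, integral_layerKernel, sign_mul_self]

lemma measurable_layerKernel : Measurable (Function.uncurry layerKernel) := by
  have h : Function.uncurry layerKernel = fun p : ℝ × ℝ =>
      {p : ℝ × ℝ | p.2 < p.1}.indicator 1 p - {p : ℝ × ℝ | p.2 < 0}.indicator 1 p := by
    ext ⟨w, z⟩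
    rw [Function.uncurry_apply_pair, layerKernel_eq]
    simp [indicator]
  rw [h]
  exact (measurable_one.indicator (measurableSet_lt measurable_snd measurable_fst)).sub
    (measurable_one.indicator (measurableSet_lt measurable_snd measurable_const))

section

variable (μ : Measure ℝ) [IsProbabilityMeasure μ] [NullSingletonClass μ]

lemma integrable_monotoneMap_mul_layerKernel (h2 : MemLp (fun z : ℝ => z) 2 μ) :
    Integrable (fun p : ℝ × ℝ => monotoneMap μ p.1 * layerKernel p.1 p.2) (μ.prod volume) := by
  refine (integrable_prod_iff ?_).2
    ⟨ae_of_all _ fun w => (integrable_layerKernel w).const_mul (monotoneMap μ w), ?_⟩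
  · exact (((measurable_monotoneMap μ).comp measurable_fst).mul
      measurable_layerKernel).aestronglyMeasurable
  · simp only [norm_mul, Real.norm_eq_abs, integral_const_mul, integral_abs_layerKernel]
    simpa [mul_comm, abs_mul] using (integrable_mul_monotoneMap μ h2).norm

lemma integral_monotoneMap_mul_layerKernel (z : ℝ) :
    ∫ w, monotoneMap μ w * layerKernel w z ∂μ = ∫ w in Ioi z, monotoneMap μ w ∂μ := by
  have h : ∀ w, monotoneMap μ w * layerKernel w z = (Ioi z).indicator (monotoneMap μ) w -
      monotoneMap μ w * (Iio (0 : ℝ)).indicator 1 z := fun w => by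
    rw [layerKernel_eq, mul_sub]
    by_cases hw : w ∈ Ioi z <;> simp [hw]
  simp_rw [h]
  rw [integral_sub ((integrable_monotoneMap μ).indicator measurableSet_Ioi)
    ((integrable_monotoneMap μ).mul_const _), integral_mul_const, integral_monotoneMap,
    integral_indicator measurableSet_Ioi]
  simp

lemma integrable_setIntegral_Ioi_monotoneMap (h2 : MemLp (fun z : ℝ => z) 2 μ) :
    Integrable fun z => ∫ w in Ioi z, monotoneMap μ w ∂μ := by
  simpa only [integral_monotoneMap_mul_layerKernel] using
    (integrable_monotoneMap_mul_layerKernel μ h2).integral_prod_right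

/-- Hoeffding's formula for the covariance of `Z` and its monotone image `Φ⁻¹(F(Z))`: it is the
Lebesgue integral of the tail integrals, by Fubini. -/
lemma integral_mul_monotoneMap (h2 : MemLp (fun z : ℝ => z) 2 μ) :
    ∫ z, z * monotoneMap μ z ∂μ = ∫ z, ∫ w in Ioi z, monotoneMap μ w ∂μ := by
  simp_rw [← integral_monotoneMap_mul_layerKernel]
  rw [← integral_integral_swap (integrable_monotoneMap_mul_layerKernel μ h2)]
  simp_rw [integral_const_mul, integral_layerKernel, mul_comm]

lemma setIntegral_Ioi_monotoneMap_nonneg (z : ℝ) : 0 ≤ ∫ w in Ioi z, monotoneMap μ w ∂μ := by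
  rw [setIntegral_Ioi_monotoneMap]
  split_ifs
  exacts [gaussianPDFReal_nonneg _ _ _, le_rfl]

lemma integral_mul_monotoneMap_nonneg (h2 : MemLp (fun z : ℝ => z) 2 μ) :
    0 ≤ ∫ z, z * monotoneMap μ z ∂μ := by
  rw [integral_mul_monotoneMap μ h2]
  exact integral_nonneg fun z => setIntegral_Ioi_monotoneMap_nonneg μ z

/-- The covariance of `Z` and `S(Z) = Φ⁻¹(F(Z))` dominates the mean of `φ(S(Z)) / (φ(Z) r(Z))`,
where `φ r` is the Lebesgue density of `Z`. The ratio is the derivative of the inverse of `S`, but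
no differentiability is needed. -/
lemma lintegral_ratio_le_integral_mul_monotoneMap (h2 : MemLp (fun z : ℝ => z) 2 μ)
    {r : ℝ → ℝ≥0∞} (hr : Measurable r) (hμ : μ = (gaussianReal 0 1).withDensity r) :
    ∫⁻ z, ENNReal.ofReal (gaussianPDFReal 0 1 (monotoneMap μ z) / gaussianPDFReal 0 1 z) / r z ∂μ ≤
      ENNReal.ofReal (∫ z, z * monotoneMap μ z ∂μ) := by
  classical
  set S := monotoneMap μ with hS
  have hSm : Measurable S := measurable_monotoneMap μ
  set q : ℝ → ℝ≥0∞ := fun z =>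
    ENNReal.ofReal (gaussianPDFReal 0 1 (S z) / gaussianPDFReal 0 1 z) with hq
  set A : Set ℝ := {z | cdf μ z ∈ Ioo (0 : ℝ) 1} with hA
  have hAm : MeasurableSet A := (cdf μ).mono.measurable measurableSet_Ioo
  have hφ := measurable_gaussianPDFReal 0 1
  have hqm : Measurable q := ((hφ.comp hSm).div hφ).ennreal_ofReal
  -- The density vanishes almost everywhere outside `{0 < F < 1}`, where `S` has no meaning.
  have hsupp : ∀ᵐ z ∂(gaussianReal 0 1), r z ≠ 0 → z ∈ A := by
    have h := ae_cdf_mem_Ioo μ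
    have h' : ∀ᵐ z ∂((gaussianReal 0 1).withDensity r), z ∈ A := by rw [← hμ]; exact h
    exact (ae_withDensity_iff hr).1 h'
  calc ∫⁻ z, q z / r z ∂μ
      = ∫⁻ z, r z * (q z / r z) ∂(gaussianReal 0 1) := by
        conv_lhs => rw [hμ]
        exact lintegral_withDensity_eq_lintegral_mul _ hr (hqm.div hr)
    _ ≤ ∫⁻ z, A.indicator q z ∂(gaussianReal 0 1) := by
        refine lintegral_mono_ae ?_
        filter_upwards [hsupp] with z hz
        by_cases h0 : r z = 0
        · simp [h0]
        · rw [indicator_of_mem (hz h0)]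
          exact ENNReal.mul_div_le
    _ = ∫⁻ z, gaussianPDF 0 1 z * A.indicator q z := by
        rw [gaussianReal_of_var_ne_zero _ one_ne_zero]
        exact lintegral_withDensity_eq_lintegral_mul _ (measurable_gaussianPDF 0 1)
          (hqm.indicator hAm)
    _ = ∫⁻ z, ENNReal.ofReal (∫ w in Ioi z, S w ∂μ) := by
        refine lintegral_congr fun z => ?_
        rw [setIntegral_Ioi_monotoneMap]
        by_cases hz : cdf μ z ∈ Ioo (0 : ℝ) 1
        · have hpos := gaussianPDFReal_pos 0 1 z one_ne_zero
          rw [indicator_of_mem (show z ∈ A from hz), if_pos hz, hq, gaussianPDF,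
            ← ENNReal.ofReal_mul hpos.le, mul_div_cancel₀ _ hpos.ne']
        · rw [indicator_of_notMem (show z ∉ A from hz), if_neg hz]
          simp
    _ = ENNReal.ofReal (∫ z, z * S z ∂μ) := by
        rw [integral_mul_monotoneMap μ h2, ofReal_integral_eq_lintegral_ofReal
          (integrable_setIntegral_Ioi_monotoneMap μ h2)
          (ae_of_all _ fun z => setIntegral_Ioi_monotoneMap_nonneg μ z)]

end

/-! ### Transports with an entropic lower bound -/

/-- The map `S` transports `μ = r γ` to `γ`, and the mean of `b(z, S z)` dominates that of a
nonnegative function `D`, which in turn dominates every affine minorant `e^c (x + d (1 - c))` of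
`d e^{x / d}`, where `x` is the logarithm of `e^{-b(S z, S z)/2} / (e^{-b(z, z)/2} r(z))`. For `γ`
the standard Gaussian law on `ℝ^d` and `b` the inner product, the latter is the ratio of the
Gaussian density at `S z` and the Lebesgue density of `μ` at `z`. The affine minorants, in
contrast to `d e^{x / d}`, add up when the dimensions do. -/
structure IsEntropicTransport {E : Type*} [MeasurableSpace E] (γ : Measure E) (b : E → E → ℝ)
    (d : ℝ) (μ : Measure E) (S : E → E) (r D : E → ℝ≥0∞) : Prop where
  map_eq : μ.map S = γ
  eq_withDensity : μ = γ.withDensity r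
  integral_nonneg : 0 ≤ ∫ z, b z (S z) ∂μ
  lintegral_le : ∫⁻ z, D z ∂μ ≤ ENNReal.ofReal (∫ z, b z (S z) ∂μ)
  le_ae : ∀ c : ℝ, ∀ᵐ z ∂μ, ENNReal.ofReal (Real.exp c *
    (d * (1 - c) + ((b z z - b (S z) (S z)) / 2 - Real.log (r z).toReal))) ≤ D z

lemma ae_ne_zero_ne_top_of_eq_withDensity {E : Type*} [MeasurableSpace E] {μ γ : Measure E}
    [IsFiniteMeasure μ] {r : E → ℝ≥0∞} (hr : Measurable r) (h : μ = γ.withDensity r) :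
    ∀ᵐ z ∂μ, r z ≠ 0 ∧ r z ≠ ⊤ := by
  have h1 : ∫⁻ z, r z ∂γ ≠ ⊤ := by
    rw [← setLIntegral_univ, ← withDensity_apply r MeasurableSet.univ, ← h]
    exact measure_ne_top μ _
  have h2 : ∀ᵐ z ∂(γ.withDensity r), r z ≠ 0 ∧ r z ≠ ⊤ := by
    rw [ae_withDensity_iff hr]
    filter_upwards [ae_lt_top hr h1] with z hz h0
    exact ⟨h0, hz.ne⟩
  rwa [← h] at h2

/-- On the line, monotone rearrangement is such a transport. -/
lemma isEntropicTransport_monotoneMap (μ : Measure ℝ) [IsProbabilityMeasure μ]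
    (h2 : MemLp (fun z : ℝ => z) 2 μ) {r : ℝ → ℝ≥0∞} (hr : Measurable r)
    (hμ : μ = (gaussianReal 0 1).withDensity r) :
    IsEntropicTransport (gaussianReal 0 1) (fun x y => x * y) 1 μ (monotoneMap μ) r
      (fun z => ENNReal.ofReal
        (gaussianPDFReal 0 1 (monotoneMap μ z) / gaussianPDFReal 0 1 z) / r z) := by
  have hac : μ ≪ gaussianReal 0 1 := hμ ▸ withDensity_absolutelyContinuous _ _
  have : NullSingletonClass μ := ⟨fun x => hac (measure_singleton x)⟩
  refine ⟨map_monotoneMap μ, hμ, integral_mul_monotoneMap_nonneg μ h2,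
    lintegral_ratio_le_integral_mul_monotoneMap μ h2 hr hμ, fun c => ?_⟩
  filter_upwards [ae_ne_zero_ne_top_of_eq_withDensity hr hμ] with z hz
  have hpos : 0 < (r z).toReal := ENNReal.toReal_pos hz.1 hz.2
  set S := monotoneMap μ z
  set y := (z * z - S * S) / 2 - Real.log (r z).toReal with hy
  have hD : ENNReal.ofReal (gaussianPDFReal 0 1 S / gaussianPDFReal 0 1 z) / r z =
      ENNReal.ofReal (Real.exp y) := by
    have h3 : Real.exp y = Real.exp (-S ^ 2 / 2) / Real.exp (-z ^ 2 / 2) / (r z).toReal := by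
      rw [hy, Real.exp_sub, Real.exp_log hpos, ← Real.exp_sub]
      ring_nf
    have h4 : gaussianPDFReal 0 1 S / gaussianPDFReal 0 1 z =
        Real.exp (-S ^ 2 / 2) / Real.exp (-z ^ 2 / 2) := by
      rw [gaussianPDFReal_zero_one, gaussianPDFReal_zero_one,
        mul_div_mul_left _ _ (by positivity)]
    rw [h3, h4, ENNReal.ofReal_div_of_pos hpos, ENNReal.ofReal_toReal hz.2]
  rw [hD]
  refine ENNReal.ofReal_le_ofReal ?_
  calc Real.exp c * (1 * (1 - c) + y) = Real.exp c * ((y - c) + 1) := by ring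
    _ ≤ Real.exp c * Real.exp (y - c) := by gcongr; exact Real.add_one_le_exp _
    _ = Real.exp y := by rw [← Real.exp_add]; ring_nf

/-- Such transports can be composed along a disintegration: the first component is moved by a
transport of its law, the second one by transports of its conditional laws. -/
lemma IsEntropicTransport.compProd {E F : Type*} [MeasurableSpace E] [MeasurableSpace F]
    {γ : Measure E} {γ' : Measure F} [IsProbabilityMeasure γ] [IsProbabilityMeasure γ']
    {b : E → E → ℝ} {b' : F → F → ℝ} {d d' : ℝ} {μ : Measure E} [IsProbabilityMeasure μ]
    {κ : Kernel E F} [IsMarkovKernel κ] {S : E → E} {r D : E → ℝ≥0∞} {S' : E × F → F}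
    {r' D' : E × F → ℝ≥0∞} (hS : Measurable S) (hr : Measurable r) (hD : Measurable D)
    (hS' : Measurable S') (hr' : Measurable r') (hD' : Measurable D')
    (hb' : Measurable (Function.uncurry b'))
    (h : IsEntropicTransport γ b d μ S r D)
    (h' : ∀ᵐ x ∂μ, IsEntropicTransport γ' b' d' (κ x) (fun y => S' (x, y)) (fun y => r' (x, y))
      (fun y => D' (x, y)))
    (hi : Integrable (fun x => b x (S x)) μ)
    (hi' : Integrable (fun p : E × F => b' p.2 (S' p)) (μ ⊗ₘ κ)) :
    IsEntropicTransport (γ.prod γ') (fun p q => b p.1 q.1 + b' p.2 q.2) (d + d') (μ ⊗ₘ κ)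
      (fun p => (S p.1, S' p)) (fun p => r p.1 * r' p) (fun p => D p.1 + D' p) := by
  have hfst : (μ ⊗ₘ κ).map Prod.fst = μ := Measure.fst_compProd μ κ
  have hSS : Measurable fun p : E × F => (S p.1, S' p) := (hS.comp measurable_fst).prodMk hS'
  have hmr : Measurable fun p : E × F => r p.1 * r' p := (hr.comp measurable_fst).mul hr'
  have hD1 : Measurable fun p : E × F => D p.1 := hD.comp measurable_fst
  have hi1 : Integrable (fun p : E × F => b p.1 (S p.1)) (μ ⊗ₘ κ) := by
    have : Integrable (fun x => b x (S x)) ((μ ⊗ₘ κ).map Prod.fst) := by rwa [hfst]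
    exact this.comp_measurable measurable_fst
  have hI : ∫ p : E × F, b p.1 (S p.1) + b' p.2 (S' p) ∂(μ ⊗ₘ κ) =
      ∫ x, b x (S x) ∂μ + ∫ x, ∫ y, b' y (S' (x, y)) ∂(κ x) ∂μ := by
    rw [integral_add hi1 hi', Measure.integral_compProd hi1, Measure.integral_compProd hi']
    simp
  have hi2 : Integrable (fun x => ∫ y, b' y (S' (x, y)) ∂(κ x)) μ :=
    Integrable.integral_compProd (κ := Kernel.const Unit μ) (η := Kernel.prodMkLeft Unit κ)
      (a := ()) hi'
  have hnn : 0 ≤ᵐ[μ] fun x => ∫ y, b' y (S' (x, y)) ∂(κ x) := by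
    filter_upwards [h'] with x hx using hx.integral_nonneg
  have hdens : μ ⊗ₘ κ = (γ.prod γ').withDensity fun p => r p.1 * r' p := by
    ext s hs
    have hm : Measurable fun p : E × F => s.indicator 1 p * r' p :=
      (measurable_one.indicator hs).mul hr'
    rw [Measure.compProd_apply hs, withDensity_apply _ hs, ← lintegral_indicator hs,
      lintegral_prod _ (hmr.indicator hs).aemeasurable]
    have h1 : ∀ᵐ x ∂μ, κ x (Prod.mk x ⁻¹' s) = ∫⁻ y, s.indicator 1 (x, y) * r' (x, y) ∂γ' := by
      filter_upwards [h'] with x hx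
      rw [hx.eq_withDensity, withDensity_apply _ (measurable_prodMk_left hs),
        ← lintegral_indicator (measurable_prodMk_left hs)]
      refine lintegral_congr fun y => ?_
      by_cases hy : (x, y) ∈ s <;> simp [indicator, hy]
    rw [lintegral_congr_ae h1]
    conv_lhs => rw [h.eq_withDensity]
    rw [lintegral_withDensity_eq_lintegral_mul _ hr hm.lintegral_prod_right']
    refine lintegral_congr fun x => ?_
    have hmx : Measurable fun y => s.indicator 1 (x, y) * r' (x, y) :=
      hm.comp measurable_prodMk_left
    rw [Pi.mul_apply, ← lintegral_const_mul _ hmx]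
    refine lintegral_congr fun y => ?_
    by_cases hy : (x, y) ∈ s <;> simp [indicator, hy]
  refine ⟨?_, hdens, ?_, ?_, fun c => ?_⟩
  · ext s hs
    rw [Measure.map_apply hSS hs, Measure.compProd_apply (hSS hs), Measure.prod_apply hs]
    conv_rhs => rw [← h.map_eq, lintegral_map (measurable_measure_prodMk_left hs) hS]
    refine lintegral_congr_ae ?_
    filter_upwards [h'] with x hx
    have hSx : Measurable fun y => S' (x, y) := hS'.comp measurable_prodMk_left
    rw [← hx.map_eq, Measure.map_apply hSx (measurable_prodMk_left hs)]
    rfl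
  · rw [hI]
    exact add_nonneg h.integral_nonneg (integral_nonneg_of_ae hnn)
  · rw [hI, lintegral_add_left hD1,
      ENNReal.ofReal_add h.integral_nonneg (integral_nonneg_of_ae hnn),
      Measure.lintegral_compProd hD1, Measure.lintegral_compProd hD',
      ofReal_integral_eq_lintegral_ofReal hi2 hnn]
    refine add_le_add ?_ (lintegral_mono_ae ?_)
    · simpa using h.lintegral_le
    · filter_upwards [h'] with x hx using hx.lintegral_le
  · have hle := h.le_ae c
    rw [← hfst] at hle
    have hle' : ∀ᵐ p : E × F ∂(μ ⊗ₘ κ), ENNReal.ofReal (Real.exp c *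
        (d' * (1 - c) + ((b' p.2 p.2 - b' (S' p) (S' p)) / 2 - Real.log (r' p).toReal))) ≤
          D' p := by
      refine Measure.ae_compProd_of_ae_ae (measurableSet_le ?_ hD') ?_
      · have h1 : Measurable fun p : E × F => b' p.2 p.2 :=
          hb'.comp (measurable_snd.prodMk measurable_snd)
        have h2 : Measurable fun p : E × F => b' (S' p) (S' p) := hb'.comp (hS'.prodMk hS')
        fun_prop
      · filter_upwards [h'] with x hx using hx.le_ae c
    filter_upwards [ae_of_ae_map measurable_fst.aemeasurable hle, hle',
      ae_ne_zero_ne_top_of_eq_withDensity hmr hdens] with p hp hp' hrp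
    have h0 : r p.1 ≠ 0 := left_ne_zero_of_mul hrp.1
    have h0' : r' p ≠ 0 := right_ne_zero_of_mul hrp.1
    have ht : r p.1 ≠ ⊤ := fun ht => hrp.2 (by rw [ht, ENNReal.top_mul h0'])
    have ht' : r' p ≠ ⊤ := fun ht => hrp.2 (by rw [ht, ENNReal.mul_top h0])
    refine le_trans ?_ (add_le_add hp hp')
    refine le_trans (le_of_eq ?_) ENNReal.ofReal_add_le
    rw [ENNReal.toReal_mul, Real.log_mul (ENNReal.toReal_pos h0 ht).ne'
      (ENNReal.toReal_pos h0' ht').ne']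
    ring_nf

lemma IsEntropicTransport.of_map_equiv {E F : Type*} [MeasurableSpace E] [MeasurableSpace F]
    {γ : Measure E} {γ' : Measure F} (e : E ≃ᵐ F) (he : MeasurePreserving e γ γ')
    {b : E → E → ℝ} {b' : F → F → ℝ} (hb : ∀ x y, b x y = b' (e x) (e y)) {d : ℝ}
    {μ : Measure E} {S : F → F} {r D : F → ℝ≥0∞} (hS : Measurable S) (hr : Measurable r)
    (h : IsEntropicTransport γ' b' d (μ.map e) S r D) :
    IsEntropicTransport γ b d μ (fun x => e.symm (S (e x))) (fun x => r (e x))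
      (fun x => D (e x)) := by
  have hI : ∫ x, b x (e.symm (S (e x))) ∂μ = ∫ y, b' y (S y) ∂(μ.map e) := by
    rw [e.measurableEmbedding.integral_map]
    simp [hb]
  refine ⟨?_, ?_, ?_, ?_, fun c => ?_⟩
  · have h1 := h.map_eq
    rw [Measure.map_map hS e.measurable, ← he.map_eq] at h1
    have h2 := congrArg (Measure.map e.symm) h1
    rw [Measure.map_map e.symm.measurable (hS.comp e.measurable),
      Measure.map_map e.symm.measurable e.measurable] at h2
    simpa [Function.comp_def] using h2
  · have h1 := h.eq_withDensity
    ext s hs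
    have h2 := congrArg (fun ν => ν (e.symm ⁻¹' s)) h1
    have hs' : MeasurableSet (e.symm ⁻¹' s) := e.symm.measurable hs
    simp only [withDensity_apply _ hs', Measure.map_apply e.measurable hs'] at h2
    rw [← he.map_eq, setLIntegral_map hs' hr e.measurable] at h2
    rw [withDensity_apply _ hs]
    simpa [← preimage_comp] using h2
  · rw [hI]; exact h.integral_nonneg
  · rw [hI, ← lintegral_map_equiv D e]; exact h.lintegral_le
  · filter_upwards [ae_of_ae_map e.measurable.aemeasurable (h.le_ae c)] with x hx
    simpa [hb] using hx

/-! ### Triangular transport in several dimensions -/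

lemma measurable_monotoneMap_kernel {𝒯 : Type*} [MeasurableSpace 𝒯] (κ : Kernel 𝒯 ℝ)
    [IsMarkovKernel κ] : Measurable fun p : 𝒯 × ℝ => monotoneMap (κ p.1) p.2 := by
  refine measurable_gaussianQuantile.comp ?_
  simp_rw [cdf_eq_real, measureReal_def]
  exact (Kernel.measurable_kernel_prodMk_left (κ := κ.prodMkRight ℝ)
    (t := {p : (𝒯 × ℝ) × ℝ | p.2 ≤ p.1.2})
    (measurableSet_le measurable_snd (measurable_snd.comp measurable_fst))).ennreal_toReal

lemma eq_withDensity_kernel_rnDeriv {𝒯 E : Type*} [MeasurableSpace 𝒯] [MeasurableSpace E]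
    [MeasurableSpace.CountableOrCountablyGenerated 𝒯 E] (κ : Kernel 𝒯 E) [IsFiniteKernel κ]
    (γ : Measure E) [IsFiniteMeasure γ] {t : 𝒯} (h : κ t ≪ γ) :
    κ t = γ.withDensity fun x => κ.rnDeriv (Kernel.const 𝒯 γ) t x := by
  have h1 := Kernel.withDensity_rnDeriv_eq (κ := κ) (η := Kernel.const 𝒯 γ) (a := t) (by simpa)
  rw [Kernel.withDensity_apply _ (Kernel.measurable_rnDeriv _ _)] at h1
  simpa using h1.symm

lemma map_compProd_eq_of_ae_map_eq {E F G : Type*} [MeasurableSpace E] [MeasurableSpace F]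
    [MeasurableSpace G] {μ : Measure E} [IsProbabilityMeasure μ] {κ : Kernel E F}
    [IsMarkovKernel κ] {S : E × F → G} (hS : Measurable S) {γ : Measure G}
    (h : ∀ᵐ x ∂μ, (κ x).map (fun y => S (x, y)) = γ) : (μ ⊗ₘ κ).map S = γ := by
  ext s hs
  rw [Measure.map_apply hS hs, Measure.compProd_apply (hS hs)]
  have h1 : ∀ᵐ x ∂μ, κ x (Prod.mk x ⁻¹' (S ⁻¹' s)) = γ s := by
    filter_upwards [h] with x hx
    have hSx : Measurable fun y => S (x, y) := hS.comp measurable_prodMk_left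
    rw [← hx, Measure.map_apply hSx hs]
    rfl
  rw [lintegral_congr_ae h1]
  simp

lemma memLp_eval_pi_gaussianReal {n : ℕ} (i : Fin n) :
    MemLp (fun y : Fin n → ℝ => y i) 2 (Measure.pi fun _ => gaussianReal 0 1) :=
  (memLp_id_gaussianReal (μ := 0) (v := 1) 2).comp_measurePreserving
    (measurePreserving_eval (fun _ : Fin n => gaussianReal 0 1) i)

/-- If `Z` and `S(Z)` have square-integrable coordinates, then `⟨Z, S(Z)⟩` is integrable; the law of
`S(Z)` is here the standard Gaussian one. -/
lemma integrable_dotProduct_of_map_eq {n : ℕ} {X : Type*} [MeasurableSpace X] {ρ : Measure X}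
    {Z S : X → Fin n → ℝ} (hZ : ∀ i, MemLp (fun x => Z x i) 2 ρ) (hS : Measurable S)
    (h : ρ.map S = Measure.pi fun _ => gaussianReal 0 1) :
    Integrable (fun x => Z x ⬝ᵥ S x) ρ := by
  refine integrable_finsetSum _ fun i _ => ?_
  have h1 := memLp_eval_pi_gaussianReal i
  rw [← h] at h1
  have h2 : MemLp (fun x => S x i) 2 ρ :=
    (memLp_map_measure_iff (measurable_pi_apply i).aestronglyMeasurable hS.aemeasurable).1 h1
  exact (hZ i).integrable_mul h2

/-- The Knothe–Rosenblatt rearrangement, with measurable dependence on a parameter: the first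
coordinate is moved by monotone rearrangement and joins the parameter, the remaining coordinates are
moved, conditionally on the first one, by induction. -/
theorem exists_isEntropicTransport (n : ℕ) : ∀ {𝒯 : Type u} [MeasurableSpace 𝒯]
    (κ : Kernel 𝒯 (Fin n → ℝ)) [IsMarkovKernel κ],
    ∃ (S : 𝒯 × (Fin n → ℝ) → Fin n → ℝ) (r D : 𝒯 × (Fin n → ℝ) → ℝ≥0∞),
      Measurable S ∧ Measurable r ∧ Measurable D ∧
      ∀ t, κ t ≪ Measure.pi (fun _ => gaussianReal 0 1) →
        (∀ i, MemLp (fun z : Fin n → ℝ => z i) 2 (κ t)) →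
        IsEntropicTransport (Measure.pi fun _ => gaussianReal 0 1) dotProduct n (κ t)
          (fun z => S (t, z)) (fun z => r (t, z)) (fun z => D (t, z)) := by
  induction n with
  | zero =>
    intro 𝒯 _ κ _
    refine ⟨fun _ => 0, fun _ => 1, fun _ => 0, by fun_prop, by fun_prop, by fun_prop,
      fun t _ _ => ?_⟩
    have h : ∀ μ ν : Measure (Fin 0 → ℝ), [IsProbabilityMeasure μ] → [IsProbabilityMeasure ν] →
        μ = ν := fun μ ν _ _ => by
      ext s _
      rcases s.eq_empty_or_nonempty with rfl | hs
      · simp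
      · rw [Subsingleton.eq_univ_of_nonempty hs, measure_univ, measure_univ]
    have := Measure.isProbabilityMeasure_map (μ := κ t)
      (f := fun _ => (0 : Fin 0 → ℝ)) (by fun_prop)
    refine ⟨h _ _, ?_, by simp, by simp, by simp⟩
    exact (h _ _).trans withDensity_one.symm
  | succ n ih =>
    intro 𝒯 _ κ _
    set γ := gaussianReal 0 1
    set γn : Measure (Fin n → ℝ) := Measure.pi fun _ => γ
    set e : (Fin (n + 1) → ℝ) ≃ᵐ ℝ × (Fin n → ℝ) :=
      MeasurableEquiv.piFinSuccAbove (fun _ => ℝ) 0 with he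
    have hepres : MeasurePreserving e (Measure.pi fun _ => γ) (γ.prod γn) :=
      measurePreserving_piFinSuccAbove (fun _ : Fin (n + 1) => γ) 0
    have he1 : ∀ x, (e x).1 = x 0 := fun x => rfl
    have he2 : ∀ x j, (e x).2 j = x j.succ := fun x j => by simp [he, Fin.tail]
    set κe : Kernel 𝒯 (ℝ × (Fin n → ℝ)) := κ.map e with hκe
    have : IsMarkovKernel κe := Kernel.IsMarkovKernel.map κ e.measurable
    -- The law of the first coordinate, and the law of the others given the parameter and the first.
    set κ0 : Kernel 𝒯 ℝ := κe.fst
    set κ1 : Kernel (𝒯 × ℝ) (Fin n → ℝ) := κe.condKernel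
    obtain ⟨S1, r1, D1, hS1, hr1, hD1, h1⟩ := ih κ1
    set S0 : 𝒯 × ℝ → ℝ := fun p => monotoneMap (κ0 p.1) p.2
    set r0 : 𝒯 × ℝ → ℝ≥0∞ := fun p => κ0.rnDeriv (Kernel.const 𝒯 γ) p.1 p.2
    set D0 : 𝒯 × ℝ → ℝ≥0∞ := fun p => ENNReal.ofReal
        (gaussianPDFReal 0 1 (S0 p) / gaussianPDFReal 0 1 p.2) / r0 p
    have hS0 : Measurable S0 := measurable_monotoneMap_kernel κ0
    have hr0 : Measurable r0 := Kernel.measurable_rnDeriv _ _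
    have hφ := measurable_gaussianPDFReal 0 1
    have hD0 : Measurable D0 :=
      ((hφ.comp hS0).div (hφ.comp measurable_snd)).ennreal_ofReal.div hr0
    have hq : Measurable fun p : 𝒯 × (Fin (n + 1) → ℝ) => ((p.1, (e p.2).1), (e p.2).2) :=
      (measurable_fst.prodMk (measurable_fst.comp (e.measurable.comp measurable_snd))).prodMk
        (measurable_snd.comp (e.measurable.comp measurable_snd))
    have hq1 := measurable_fst.comp hq
    refine ⟨fun p => e.symm (S0 (p.1, (e p.2).1), S1 ((p.1, (e p.2).1), (e p.2).2)),
      fun p => r0 (p.1, (e p.2).1) * r1 ((p.1, (e p.2).1), (e p.2).2),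
      fun p => D0 (p.1, (e p.2).1) + D1 ((p.1, (e p.2).1), (e p.2).2),
      e.symm.measurable.comp ((hS0.comp hq1).prodMk (hS1.comp hq)),
      (hr0.comp hq1).mul (hr1.comp hq), (hD0.comp hq1).add (hD1.comp hq), fun t hac h2 => ?_⟩
    have hdis : (κ t).map e = κ0 t ⊗ₘ κ1.sectR t := by
      rw [← Kernel.compProd_apply_eq_compProd_sectR, Kernel.disintegrate κe κ1, hκe,
        Kernel.map_apply _ e.measurable]
    have hac' : κ0 t ⊗ₘ κ1.sectR t ≪ γ ⊗ₘ Kernel.const ℝ γn := by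
      rw [Measure.compProd_const, ← hdis, ← hepres.map_eq]
      exact hac.map e.measurable
    have hmom : ∀ f : ℝ × (Fin n → ℝ) → ℝ, Measurable f → MemLp (f ∘ e) 2 (κ t) →
        MemLp f 2 (κ0 t ⊗ₘ κ1.sectR t) := fun f hf h => by
      rw [← hdis]
      exact (memLp_map_measure_iff hf.aestronglyMeasurable e.measurable.aemeasurable).2 h
    have hm0 : MemLp (fun p : ℝ × (Fin n → ℝ) => p.1) 2 (κ0 t ⊗ₘ κ1.sectR t) :=
      hmom _ measurable_fst (h2 0)
    have hm1 : ∀ i, MemLp (fun p : ℝ × (Fin n → ℝ) => p.2 i) 2 (κ0 t ⊗ₘ κ1.sectR t) := fun i =>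
      hmom _ (by fun_prop) (by simpa [Function.comp_def, he2] using h2 i.succ)
    have hm0' : MemLp (fun z : ℝ => z) 2 (κ0 t) := by
      rw [← Measure.fst_compProd (κ0 t) (κ1.sectR t)]
      exact (memLp_map_measure_iff (by fun_prop) measurable_fst.aemeasurable).2 hm0
    have hm1' : ∀ᵐ x ∂(κ0 t), ∀ i, MemLp (fun z : Fin n → ℝ => z i) 2 (κ1 (t, x)) := by
      rw [ae_all_iff]
      intro i
      have hint := (Measure.integrable_compProd_iff (by fun_prop)).1 (hm1 i).integrable_sq
      filter_upwards [hint.1] with x hx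
      exact (memLp_two_iff_integrable_sq (measurable_pi_apply i).aestronglyMeasurable).2 hx
    have hac0 : κ0 t ≪ γ := Measure.absolutelyContinuous_of_compProd hac'
    have hac1 : ∀ᵐ x ∂(κ0 t), κ1 (t, x) ≪ γn := hac'.kernel_of_compProd
    have hT0 := isEntropicTransport_monotoneMap (κ0 t) hm0'
      (hr0.comp measurable_prodMk_left) (eq_withDensity_kernel_rnDeriv κ0 γ hac0)
    have hT1 : ∀ᵐ x ∂(κ0 t), IsEntropicTransport γn dotProduct n (κ1.sectR t x)
        (fun y => S1 ((t, x), y)) (fun y => r1 ((t, x), y)) (fun y => D1 ((t, x), y)) := by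
      filter_upwards [hac1, hm1'] with x hx hx' using h1 (t, x) hx hx'
    have hp : Measurable fun p : ℝ × (Fin n → ℝ) => ((t, p.1), p.2) :=
      (measurable_prodMk_left.comp measurable_fst).prodMk measurable_snd
    have hmap : (κ0 t ⊗ₘ κ1.sectR t).map (fun p => S1 ((t, p.1), p.2)) = γn :=
      map_compProd_eq_of_ae_map_eq (hS1.comp hp) (hT1.mono fun x hx => hx.map_eq)
    have hi0 : Integrable (fun x => x * S0 (t, x)) (κ0 t) := by
      have : NullSingletonClass (κ0 t) := ⟨fun x => hac0 (measure_singleton x)⟩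
      exact integrable_mul_monotoneMap (κ0 t) hm0'
    have hb : Measurable (Function.uncurry (dotProduct (m := Fin n) (α := ℝ))) := by
      unfold Function.uncurry dotProduct
      fun_prop
    have hT := IsEntropicTransport.compProd (hS0.comp measurable_prodMk_left)
      (hr0.comp measurable_prodMk_left) (hD0.comp measurable_prodMk_left) (hS1.comp hp)
      (hr1.comp hp) (hD1.comp hp) hb hT0 hT1 hi0
      (integrable_dotProduct_of_map_eq hm1 (hS1.comp hp) hmap)
    rw [← hdis] at hT
    have hfin := hT.of_map_equiv e hepres (b := dotProduct) (fun x y => by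
      simp [dotProduct, Fin.sum_univ_succ, he1, he2])
      (((hS0.comp measurable_prodMk_left).comp measurable_fst).prodMk (hS1.comp hp))
      (((hr0.comp measurable_prodMk_left).comp measurable_fst).mul (hr1.comp hp))
    have hn : ((n + 1 : ℕ) : ℝ) = 1 + n := by push_cast; ring
    rw [hn]
    exact hfin

/-! ### The standard Gaussian law on Euclidean space -/

/-- The Lebesgue density `(2π)^{-n/2} exp(-‖x‖² / 2)` of the standard Gaussian law on `ℝⁿ`. -/
noncomputable def stdGaussianPDF {n : ℕ} (x : EuclideanSpace ℝ (Fin n)) : ℝ :=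
  (√(2 * Real.pi))⁻¹ ^ n * Real.exp (-‖x‖ ^ 2 / 2)

lemma stdGaussianPDF_pos {n : ℕ} (x : EuclideanSpace ℝ (Fin n)) : 0 < stdGaussianPDF x := by
  unfold stdGaussianPDF
  positivity

lemma measurable_stdGaussianPDF {n : ℕ} :
    Measurable (stdGaussianPDF : EuclideanSpace ℝ (Fin n) → ℝ) := by
  unfold stdGaussianPDF
  fun_prop

lemma stdGaussianPDF_toLp {n : ℕ} (x : Fin n → ℝ) :
    stdGaussianPDF (WithLp.toLp 2 x) = ∏ i, gaussianPDFReal 0 1 (x i) := by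
  simp_rw [gaussianPDFReal_zero_one, Finset.prod_mul_distrib, ← Real.exp_sum]
  simp [stdGaussianPDF, EuclideanSpace.real_norm_sq_eq, neg_div, Finset.sum_div]

lemma log_stdGaussianPDF {n : ℕ} (x : EuclideanSpace ℝ (Fin n)) :
    Real.log (stdGaussianPDF x) = -(n / 2 * Real.log (2 * Real.pi) + ‖x‖ ^ 2 / 2) := by
  rw [stdGaussianPDF, Real.log_mul (by positivity) (by positivity), Real.log_exp, Real.log_pow,
    Real.log_inv, Real.log_sqrt (by positivity)]
  ring

lemma pi_gaussianReal_eq_withDensity (n : ℕ) :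
    Measure.pi (fun _ : Fin n => gaussianReal 0 1) =
      volume.withDensity fun x => ENNReal.ofReal (∏ i, gaussianPDFReal 0 1 (x i)) := by
  refine Measure.pi_eq fun s hs => ?_
  rw [withDensity_apply _ (MeasurableSet.univ_pi hs), volume_pi, Measure.restrict_pi_pi]
  have hint : ∀ i, Integrable (gaussianPDFReal 0 1) (volume.restrict (s i)) := fun i =>
    (integrable_gaussianPDFReal 0 1).restrict
  rw [← ofReal_integral_eq_lintegral_ofReal (Integrable.fintype_prod hint)
    (ae_of_all _ fun x => Finset.prod_nonneg fun i _ => gaussianPDFReal_nonneg _ _ _),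
    integral_fintype_prod_eq_prod, ENNReal.ofReal_prod_of_nonneg
      fun i _ => integral_nonneg fun x => gaussianPDFReal_nonneg _ _ _]
  exact Finset.prod_congr rfl fun i _ => (gaussianReal_apply_eq_integral 0 one_ne_zero (s i)).symm

lemma stdGaussian_eq_withDensity (n : ℕ) : stdGaussian (EuclideanSpace ℝ (Fin n)) =
    volume.withDensity fun x => ENNReal.ofReal (stdGaussianPDF x) := by
  have hm : Measurable (WithLp.toLp 2 : (Fin n → ℝ) → EuclideanSpace ℝ (Fin n)) := by fun_prop
  rw [← map_pi_eq_stdGaussian, pi_gaussianReal_eq_withDensity]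
  ext s hs
  rw [Measure.map_apply hm hs, withDensity_apply _ (hm hs), withDensity_apply _ hs,
    ← (PiLp.volume_preserving_toLp (Fin n)).setLIntegral_comp_preimage hs
      measurable_stdGaussianPDF.ennreal_ofReal]
  simp_rw [stdGaussianPDF_toLp]

lemma absolutelyContinuous_volume_of_stdGaussian {n : ℕ}
    {μ : Measure (EuclideanSpace ℝ (Fin n))} (h : μ ≪ stdGaussian (EuclideanSpace ℝ (Fin n))) :
    μ ≪ volume :=
  h.trans (stdGaussian_eq_withDensity n ▸ withDensity_absolutelyContinuous _ _)

lemma rnDeriv_volume_ae_eq {n : ℕ} {μ : Measure (EuclideanSpace ℝ (Fin n))}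
    {r : EuclideanSpace ℝ (Fin n) → ℝ≥0∞} (hr : Measurable r)
    (h : μ = (stdGaussian (EuclideanSpace ℝ (Fin n))).withDensity r) :
    μ.rnDeriv volume =ᵐ[volume] fun x => ENNReal.ofReal (stdGaussianPDF x) * r x := by
  have hφ : Measurable fun x : EuclideanSpace ℝ (Fin n) => ENNReal.ofReal (stdGaussianPDF x) :=
    measurable_stdGaussianPDF.ennreal_ofReal
  have h1 := Measure.rnDeriv_withDensity volume (hφ.mul hr)
  rwa [withDensity_mul _ hφ hr, ← stdGaussian_eq_withDensity, ← h] at h1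

lemma memLp_id_stdGaussian (n : ℕ) :
    MemLp (fun x : EuclideanSpace ℝ (Fin n) => x) 2 (stdGaussian (EuclideanSpace ℝ (Fin n))) :=
  IsGaussian.memLp_two_id

lemma integral_norm_sq_stdGaussian (n : ℕ) :
    ∫ x, ‖x‖ ^ 2 ∂(stdGaussian (EuclideanSpace ℝ (Fin n))) = n := by
  have hm : Measurable (WithLp.toLp 2 : (Fin n → ℝ) → EuclideanSpace ℝ (Fin n)) := by fun_prop
  rw [← map_pi_eq_stdGaussian, integral_map hm.aemeasurable (by fun_prop)]
  simp_rw [EuclideanSpace.real_norm_sq_eq]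
  have h1 : ∀ i : Fin n, ∫ x : Fin n → ℝ, x i ^ 2 ∂(Measure.pi fun _ => gaussianReal 0 1) = 1 :=
      fun i => by
    have h := (measurePreserving_eval (fun _ : Fin n => gaussianReal 0 1) i)
    have h2 := integral_map (μ := Measure.pi fun _ : Fin n => gaussianReal 0 1)
      h.measurable.aemeasurable (f := fun y : ℝ => y ^ 2) (by fun_prop)
    rw [h.map_eq] at h2
    refine h2.symm.trans ?_
    have h3 := variance_fun_id_gaussianReal (μ := 0) (v := 1)
    rw [variance_of_integral_eq_zero (by fun_prop) (by simp)] at h3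
    simpa using h3
  rw [integral_finsetSum _ fun i _ => (memLp_eval_pi_gaussianReal i).integrable_sq]
  simp [h1]

/-- The Knothe–Rosenblatt rearrangement on Euclidean space. -/
theorem exists_isEntropicTransport_euclideanSpace (n : ℕ) {𝒯 : Type u} [MeasurableSpace 𝒯]
    (κ : Kernel 𝒯 (EuclideanSpace ℝ (Fin n))) [IsMarkovKernel κ] :
    ∃ (S : 𝒯 × EuclideanSpace ℝ (Fin n) → EuclideanSpace ℝ (Fin n))
      (r D : 𝒯 × EuclideanSpace ℝ (Fin n) → ℝ≥0∞),
      Measurable S ∧ Measurable r ∧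
      ∀ t, κ t ≪ stdGaussian (EuclideanSpace ℝ (Fin n)) → MemLp (fun z => z) 2 (κ t) →
        IsEntropicTransport (stdGaussian (EuclideanSpace ℝ (Fin n))) (fun x y => inner ℝ x y) n
          (κ t) (fun z => S (t, z)) (fun z => r (t, z)) (fun z => D (t, z)) := by
  set e : EuclideanSpace ℝ (Fin n) ≃ᵐ (Fin n → ℝ) := (MeasurableEquiv.toLp 2 (Fin n → ℝ)).symm
  have hepres : MeasurePreserving e (stdGaussian (EuclideanSpace ℝ (Fin n)))
      (Measure.pi fun _ => gaussianReal 0 1) := by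
    refine ⟨e.measurable, ?_⟩
    rw [← map_pi_eq_stdGaussian]
    exact MeasurableEquiv.map_map_symm (e := e)
  have : IsMarkovKernel (κ.map e) := Kernel.IsMarkovKernel.map κ e.measurable
  obtain ⟨S, r, D, hS, hr, hD, h⟩ := exists_isEntropicTransport n (κ.map e)
  have hp : Measurable fun p : 𝒯 × EuclideanSpace ℝ (Fin n) => (p.1, e p.2) :=
    measurable_fst.prodMk (e.measurable.comp measurable_snd)
  refine ⟨fun p => e.symm (S (p.1, e p.2)), fun p => r (p.1, e p.2), fun p => D (p.1, e p.2),
    e.symm.measurable.comp (hS.comp hp), hr.comp hp, fun t hac h2 => ?_⟩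
  have ht := h t (by
    rw [Kernel.map_apply _ e.measurable, ← hepres.map_eq]
    exact hac.map e.measurable) fun i => by
      rw [Kernel.map_apply _ e.measurable]
      refine (memLp_map_measure_iff (measurable_pi_apply i).aestronglyMeasurable
        e.measurable.aemeasurable).2 ?_
      exact (EuclideanSpace.proj (𝕜 := ℝ) i).comp_memLp' h2
  rw [Kernel.map_apply _ e.measurable] at ht
  refine ht.of_map_equiv e hepres (fun x y => ?_) (hS.comp measurable_prodMk_left)
    (hr.comp measurable_prodMk_left)
  rw [EuclideanSpace.inner_eq_star_dotProduct, dotProduct_comm]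
  rfl

/-! ### Differential entropy -/

section

variable {n : ℕ} (μ : Measure (EuclideanSpace ℝ (Fin n)))

/-- The positive part `∫ (f log f)⁻` of the differential entropy of a law with density `f`. -/
noncomputable def entropyPos : ℝ≥0∞ :=
  ∫⁻ x, ENNReal.ofReal (Real.negMulLog (μ.rnDeriv volume x).toReal)

/-- The negative part `∫ (f log f)⁺` of the differential entropy of a law with density `f`. -/
noncomputable def entropyNeg : ℝ≥0∞ :=
  ∫⁻ x, ENNReal.ofReal (-Real.negMulLog (μ.rnDeriv volume x).toReal)

lemma diffEntropy_eq : diffEntropy μ = (entropyPos μ : EReal) - (entropyNeg μ : EReal) := by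
  simp only [diffEntropy, extIntegral, entropyPos, entropyNeg, ← EReal.coe_neg,
    EReal.real_coe_toENNReal]

/-- Gibbs' inequality, pointwise and with the Gaussian density as reference. -/
lemma negMulLog_le_gaussian {f : ℝ} (hf : 0 ≤ f) (x : EuclideanSpace ℝ (Fin n)) :
    Real.negMulLog f ≤ f * (n / 2 * Real.log (2 * Real.pi) + ‖x‖ ^ 2 / 2) + stdGaussianPDF x := by
  have hq := stdGaussianPDF_pos x
  rcases hf.eq_or_lt with rfl | hf
  · simpa using hq.le
  · have h1 := Real.log_le_sub_one_of_pos (div_pos hq hf)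
    rw [Real.log_div hq.ne' hf.ne', log_stdGaussianPDF] at h1
    have h2 := mul_le_mul_of_nonneg_left h1 hf.le
    have h3 : f * (stdGaussianPDF x / f - 1) = stdGaussianPDF x - f := by field_simp
    rw [h3] at h2
    rw [Real.negMulLog]
    nlinarith

/-- A finite second moment bounds the positive part of the differential entropy. -/
lemma entropyPos_le [IsProbabilityMeasure μ] (hac : μ ≪ volume) :
    entropyPos μ ≤ ENNReal.ofReal (n / 2 * Real.log (2 * Real.pi)) + ∫⁻ x, ‖x‖ₑ ^ 2 ∂μ + 1 := by
  set C := n / 2 * Real.log (2 * Real.pi) with hC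
  have hC0 : 0 ≤ C := mul_nonneg (by positivity) (Real.log_nonneg (by
    have := Real.pi_gt_three; linarith))
  have hq1 : ∫⁻ x : EuclideanSpace ℝ (Fin n), ENNReal.ofReal (stdGaussianPDF x) = 1 := by
    rw [← setLIntegral_univ, ← withDensity_apply _ MeasurableSet.univ,
      ← stdGaussian_eq_withDensity, measure_univ]
  calc entropyPos μ
      ≤ ∫⁻ x, (μ.rnDeriv volume x * (ENNReal.ofReal C + ‖x‖ₑ ^ 2) +
          ENNReal.ofReal (stdGaussianPDF x)) := by
        refine lintegral_mono fun x => ?_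
        refine (ENNReal.ofReal_le_ofReal
          (negMulLog_le_gaussian ENNReal.toReal_nonneg x)).trans ?_
        refine ENNReal.ofReal_add_le.trans (add_le_add ?_ le_rfl)
        rw [ENNReal.ofReal_mul ENNReal.toReal_nonneg]
        refine mul_le_mul' ENNReal.ofReal_toReal_le (ENNReal.ofReal_add_le.trans ?_)
        refine add_le_add le_rfl ?_
        rw [← ofReal_norm, ← ENNReal.ofReal_pow (norm_nonneg _)]
        exact ENNReal.ofReal_le_ofReal (by nlinarith [sq_nonneg ‖x‖])
    _ = ∫⁻ x, (ENNReal.ofReal C + ‖x‖ₑ ^ 2) ∂μ + 1 := by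
        rw [lintegral_add_right _ measurable_stdGaussianPDF.ennreal_ofReal, hq1,
          lintegral_rnDeriv_mul hac (by fun_prop)]
    _ = _ := by
        rw [lintegral_add_left measurable_const]
        simp

lemma measurable_entropyPos_entropyNeg {𝒯 : Type*} [MeasurableSpace 𝒯]
    (κ : Kernel 𝒯 (EuclideanSpace ℝ (Fin n))) [IsMarkovKernel κ]
    (hac : ∀ t, κ t ≪ stdGaussian (EuclideanSpace ℝ (Fin n))) :
    (Measurable fun t => entropyPos (κ t)) ∧ Measurable fun t => entropyNeg (κ t) := by
  set r : 𝒯 × EuclideanSpace ℝ (Fin n) → ℝ≥0∞ := fun p =>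
    κ.rnDeriv (Kernel.const 𝒯 (stdGaussian _)) p.1 p.2
  have hr : Measurable r := Kernel.measurable_rnDeriv _ _
  set f : 𝒯 × EuclideanSpace ℝ (Fin n) → ℝ := fun p =>
    Real.negMulLog (ENNReal.ofReal (stdGaussianPDF p.2) * r p).toReal
  have hf : Measurable f := Real.continuous_negMulLog.measurable.comp
    (((measurable_stdGaussianPDF.comp measurable_snd).ennreal_ofReal.mul hr).ennreal_toReal)
  have hae : ∀ t, (fun x => Real.negMulLog ((κ t).rnDeriv volume x).toReal) =ᵐ[volume]
      fun x => f (t, x) := fun t => by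
    filter_upwards [rnDeriv_volume_ae_eq (hr.comp measurable_prodMk_left)
      (eq_withDensity_kernel_rnDeriv κ _ (hac t))] with x hx
    rw [hx]
    rfl
  have h1 : ∀ t, entropyPos (κ t) = ∫⁻ x, ENNReal.ofReal (f (t, x)) := fun t =>
    lintegral_congr_ae ((hae t).mono fun x hx => congrArg ENNReal.ofReal hx)
  have h2 : ∀ t, entropyNeg (κ t) = ∫⁻ x, ENNReal.ofReal (-f (t, x)) := fun t =>
    lintegral_congr_ae ((hae t).mono fun x hx => congrArg (fun y => ENNReal.ofReal (-y)) hx)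
  simp_rw [h1, h2]
  exact ⟨hf.ennreal_ofReal.lintegral_prod_right', hf.neg.ennreal_ofReal.lintegral_prod_right'⟩

lemma measurable_toReal_rnDeriv : Measurable fun x => (μ.rnDeriv volume x).toReal :=
  (μ.measurable_rnDeriv volume).ennreal_toReal

lemma integrable_negMulLog (hp : entropyPos μ ≠ ⊤) (hq : entropyNeg μ ≠ ⊤) :
    Integrable fun x => Real.negMulLog (μ.rnDeriv volume x).toReal := by
  have hm : Measurable fun x => Real.negMulLog (μ.rnDeriv volume x).toReal :=
    Real.continuous_negMulLog.measurable.comp (measurable_toReal_rnDeriv μ)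
  refine ⟨hm.aestronglyMeasurable, ?_⟩
  have h : ∀ x : ℝ, ‖x‖ₑ = ENNReal.ofReal x + ENNReal.ofReal (-x) := fun x => by
    rw [Real.enorm_eq_ofReal_abs]
    rcases le_total 0 x with hx | hx
    · simp [abs_of_nonneg hx, ENNReal.ofReal_of_nonpos (neg_nonpos.2 hx)]
    · simp [abs_of_nonpos hx, ENNReal.ofReal_of_nonpos hx]
  simp_rw [HasFiniteIntegral, h]
  rw [lintegral_add_left hm.ennreal_ofReal]
  exact ENNReal.add_lt_top.2 ⟨hp.lt_top, hq.lt_top⟩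

lemma integrable_log_rnDeriv [IsProbabilityMeasure μ] (hac : μ ≪ volume)
    (hp : entropyPos μ ≠ ⊤) (hq : entropyNeg μ ≠ ⊤) :
    Integrable (fun x => Real.log (μ.rnDeriv volume x).toReal) μ := by
  have h := (integrable_negMulLog μ hp hq).neg
  rw [← integrable_rnDeriv_smul_iff hac]
  refine h.congr (ae_of_all _ fun x => ?_)
  simp [Real.negMulLog]

lemma integral_log_rnDeriv [IsProbabilityMeasure μ] (hac : μ ≪ volume)
    (hp : entropyPos μ ≠ ⊤) (hq : entropyNeg μ ≠ ⊤) :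
    ∫ x, Real.log (μ.rnDeriv volume x).toReal ∂μ =
      -((entropyPos μ).toReal - (entropyNeg μ).toReal) := by
  rw [← integral_rnDeriv_smul hac]
  have h := integral_eq_lintegral_pos_part_sub_lintegral_neg_part (integrable_negMulLog μ hp hq)
  rw [entropyPos, entropyNeg, ← h, ← integral_neg]
  simp [Real.negMulLog]

end

/-- The entropic lower bound for the correlation between `Z` and its Gaussian transport. It is the
tangent-line form, at `c`, of `E⟨Z, S(Z)⟩ ≥ n e^{h/n} / √(2πe)`. -/
lemma IsEntropicTransport.exp_mul_le_integral {n : ℕ} {μ : Measure (EuclideanSpace ℝ (Fin n))}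
    [IsProbabilityMeasure μ] {S : EuclideanSpace ℝ (Fin n) → EuclideanSpace ℝ (Fin n)}
    {r D : EuclideanSpace ℝ (Fin n) → ℝ≥0∞} (hS : Measurable S) (hr : Measurable r)
    (h : IsEntropicTransport (stdGaussian (EuclideanSpace ℝ (Fin n))) (fun x y => inner ℝ x y) n μ
      S r D)
    (hp : entropyPos μ ≠ ⊤) (hq : entropyNeg μ ≠ ⊤) (c : ℝ) :
    Real.exp c * (n * (1 - c) + ((entropyPos μ).toReal - (entropyNeg μ).toReal) -
      n / 2 * Real.log (2 * Real.pi * Real.exp 1)) ≤ ∫ z, inner ℝ z (S z) ∂μ := by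
  have hac : μ ≪ volume := absolutelyContinuous_volume_of_stdGaussian
    (h.eq_withDensity ▸ withDensity_absolutelyContinuous _ _)
  have hrn : ∀ᵐ x ∂μ, μ.rnDeriv volume x = ENNReal.ofReal (stdGaussianPDF x) * r x :=
    hac.ae_le (rnDeriv_volume_ae_eq hr h.eq_withDensity)
  have hlog : ∀ᵐ x ∂μ, Real.log (μ.rnDeriv volume x).toReal =
      -(n / 2 * Real.log (2 * Real.pi) + ‖x‖ ^ 2 / 2) + Real.log (r x).toReal := by
    filter_upwards [hrn, ae_ne_zero_ne_top_of_eq_withDensity hr h.eq_withDensity] with x hx hx'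
    rw [hx, ENNReal.toReal_mul, ENNReal.toReal_ofReal (stdGaussianPDF_pos x).le,
      Real.log_mul (stdGaussianPDF_pos x).ne' (ENNReal.toReal_pos hx'.1 hx'.2).ne',
      log_stdGaussianPDF]
  have hSint : Integrable (fun z => ‖S z‖ ^ 2) μ := by
    have h1 := (memLp_id_stdGaussian n).norm.integrable_sq
    rw [← h.map_eq] at h1
    exact h1.comp_measurable hS
  have hSval : ∫ z, ‖S z‖ ^ 2 ∂μ = n := by
    rw [← integral_norm_sq_stdGaussian n, ← h.map_eq, integral_map hS.aemeasurable (by fun_prop)]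
  have hlint := integrable_log_rnDeriv μ hac hp hq
  set g : EuclideanSpace ℝ (Fin n) → ℝ := fun z => Real.exp c *
    (n * (1 - c) - n / 2 * Real.log (2 * Real.pi) - ‖S z‖ ^ 2 / 2 -
      Real.log (μ.rnDeriv volume z).toReal) with hg
  have hint : Integrable (fun z => n * (1 - c) - n / 2 * Real.log (2 * Real.pi) - ‖S z‖ ^ 2 / 2)
      μ := (integrable_const _).sub (hSint.div_const 2)
  have hgint : Integrable g μ := (hint.sub hlint).const_mul _
  have hgval : ∫ z, g z ∂μ = Real.exp c * (n * (1 - c) +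
      ((entropyPos μ).toReal - (entropyNeg μ).toReal) -
        n / 2 * Real.log (2 * Real.pi * Real.exp 1)) := by
    rw [hg, integral_const_mul, integral_sub hint hlint,
      integral_sub (integrable_const _) (hSint.div_const 2), integral_div, hSval,
      integral_log_rnDeriv μ hac hp hq,
      Real.log_mul (x := 2 * Real.pi) (by positivity) (by positivity), Real.log_exp,
      integral_const, probReal_univ, one_smul]
    ring
  rw [← hgval]
  have hle : ENNReal.ofReal (∫ z, g z ∂μ) ≤ ENNReal.ofReal (∫ z, inner ℝ z (S z) ∂μ) := by
    calc ENNReal.ofReal (∫ z, g z ∂μ) ≤ ∫⁻ z, ENNReal.ofReal (g z) ∂μ := by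
          refine ENNReal.ofReal_le_of_le_toReal ?_
          rw [integral_eq_lintegral_pos_part_sub_lintegral_neg_part hgint]
          exact sub_le_self _ ENNReal.toReal_nonneg
      _ ≤ ∫⁻ z, D z ∂μ := by
          refine lintegral_mono_ae ?_
          filter_upwards [h.le_ae c, hlog] with z hz hz'
          refine le_trans (le_of_eq ?_) hz
          simp only [hg, hz', real_inner_self_eq_norm_sq]
          ring_nf
      _ ≤ _ := h.lintegral_le
  exact (ENNReal.ofReal_le_ofReal_iff h.integral_nonneg).1 hle

/-! ### The cost of a transport coupling -/

lemma memLp_id_of_hasFiniteMoment {n : ℕ} {μ : Measure (EuclideanSpace ℝ (Fin n))}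
    [IsFiniteMeasure μ] (h : HasFiniteMoment 2 μ) : MemLp (fun z => z) 2 μ := by
  obtain ⟨a, ha⟩ := h
  have h1 : MemLp (fun z => z - a) 2 μ := by
    refine ⟨by fun_prop, ?_⟩
    rw [eLpNorm_lt_top_iff_lintegral_rpow_enorm_lt_top (by norm_num) (by norm_num)]
    simpa [edist_eq_enorm_sub] using ha
  refine (h1.add (memLp_const a)).congr_norm (by fun_prop) (ae_of_all _ fun z => ?_)
  simp

/-- Moving `Z` by maps `S(t, ·)` that transport the conditional laws is an admissible coupling. -/
lemma condWasserstein_sq_le {𝒯 E : Type*} [MeasurableSpace 𝒯] [NormedAddCommGroup E]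
    [MeasurableSpace E] [BorelSpace E] [SecondCountableTopology E] (PT : Measure 𝒯) [SFinite PT]
    (PZ PY : Kernel 𝒯 E) [IsMarkovKernel PZ] {S : 𝒯 × E → E} (hS : Measurable S)
    (h : ∀ t, (PZ t).map (fun z => S (t, z)) = PY t) :
    condWasserstein 2 PT PZ PY ^ 2 ≤ ∫⁻ t, ∫⁻ z, ‖z - S (t, z)‖ₑ ^ 2 ∂(PZ t) ∂PT := by
  -- The conditional law of `(Z, S(T, Z))`.
  set κ : Kernel 𝒯 (E × E) := PZ ⊗ₖ Kernel.deterministic S hS with hκ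
  have hκt : ∀ t, κ t = (PZ t).map (fun z => (z, S (t, z))) := fun t => by
    have hm : Measurable fun z => (z, S (t, z)) :=
      measurable_id.prodMk (hS.comp measurable_prodMk_left)
    ext s hs
    rw [hκ, Kernel.compProd_apply hs, Measure.map_apply hm hs, ← lintegral_indicator_one (hm hs)]
    refine lintegral_congr fun z => ?_
    rw [Kernel.deterministic_apply' _ _ (measurable_prodMk_left hs)]
    rfl
  have hmem : PT ⊗ₘ κ ∈ condCouplings PT PZ PY := by
    refine ⟨κ, inferInstance, Kernel.fst_compProd _ _, ?_, rfl⟩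
    ext1 t
    have hm : Measurable fun z => (z, S (t, z)) :=
      measurable_id.prodMk (hS.comp measurable_prodMk_left)
    rw [Kernel.snd_apply, hκt, Measure.map_map measurable_snd hm, ← h t]
    rfl
  have hle : condWasserstein 2 PT PZ PY ≤
      (∫⁻ x, edist x.2.1 x.2.2 ^ (2 : ℝ) ∂(PT ⊗ₘ κ)) ^ (1 / 2 : ℝ) := iInf₂_le _ hmem
  have hcost : Measurable fun x : 𝒯 × E × E => edist x.2.1 x.2.2 ^ (2 : ℝ) := by fun_prop
  have hcost' : Measurable fun x : E × E => edist x.1 x.2 ^ (2 : ℝ) := by fun_prop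
  calc condWasserstein 2 PT PZ PY ^ 2
      ≤ ((∫⁻ x, edist x.2.1 x.2.2 ^ (2 : ℝ) ∂(PT ⊗ₘ κ)) ^ (1 / 2 : ℝ)) ^ 2 := by gcongr
    _ = ∫⁻ x, edist x.2.1 x.2.2 ^ (2 : ℝ) ∂(PT ⊗ₘ κ) := by
        rw [← ENNReal.rpow_natCast, ← ENNReal.rpow_mul]
        simp
    _ = ∫⁻ t, ∫⁻ z, ‖z - S (t, z)‖ₑ ^ 2 ∂(PZ t) ∂PT := by
        rw [Measure.lintegral_compProd hcost]
        refine lintegral_congr fun t => ?_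
        have hm : Measurable fun z => (z, S (t, z)) :=
          measurable_id.prodMk (hS.comp measurable_prodMk_left)
        rw [hκt, lintegral_map hcost' hm]
        simp [edist_eq_enorm_sub]

section

variable {n : ℕ} {μ : Measure (EuclideanSpace ℝ (Fin n))}
  {S : EuclideanSpace ℝ (Fin n) → EuclideanSpace ℝ (Fin n)}

lemma memLp_of_map_eq_stdGaussian (hS : Measurable S)
    (h : μ.map S = stdGaussian (EuclideanSpace ℝ (Fin n))) : MemLp S 2 μ := by
  have h1 := memLp_id_stdGaussian n
  rw [← h] at h1
  exact (memLp_map_measure_iff (by fun_prop) hS.aemeasurable).1 h1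

lemma integral_norm_sq_of_map_eq_stdGaussian (hS : Measurable S)
    (h : μ.map S = stdGaussian (EuclideanSpace ℝ (Fin n))) : ∫ z, ‖S z‖ ^ 2 ∂μ = n := by
  rw [← integral_norm_sq_stdGaussian n, ← h, integral_map hS.aemeasurable (by fun_prop)]

lemma lintegral_enorm_sub_sq_eq (h2 : MemLp (fun z => z) 2 μ) (hS : Measurable S)
    (h : μ.map S = stdGaussian (EuclideanSpace ℝ (Fin n))) :
    0 ≤ ∫ z, ‖z‖ ^ 2 ∂μ + n - 2 * ∫ z, inner ℝ z (S z) ∂μ ∧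
    ∫⁻ z, ‖z - S z‖ₑ ^ 2 ∂μ =
      ENNReal.ofReal (∫ z, ‖z‖ ^ 2 ∂μ + n - 2 * ∫ z, inner ℝ z (S z) ∂μ) := by
  have hSL := memLp_of_map_eq_stdGaussian hS h
  have h1 : Integrable (fun z => ‖z‖ ^ 2) μ := h2.norm.integrable_sq
  have h3 : Integrable (fun z => ‖S z‖ ^ 2) μ := hSL.norm.integrable_sq
  have h4 : Integrable (fun z => inner ℝ z (S z)) μ :=
    (h1.add h3).mono' (by fun_prop) (ae_of_all _ fun z => by
      have := norm_inner_le_norm (𝕜 := ℝ) z (S z)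
      simp only [Pi.add_apply]
      nlinarith [sq_nonneg (‖z‖ - ‖S z‖), sq_nonneg ‖z‖, sq_nonneg ‖S z‖])
  have h6 : Integrable (fun z => ‖z‖ ^ 2 - 2 * inner ℝ z (S z)) μ := h1.sub (h4.const_mul 2)
  have h7 : Integrable (fun z => ‖z - S z‖ ^ 2) μ := (h2.sub hSL).norm.integrable_sq
  have h5 : ∫ z, ‖z - S z‖ ^ 2 ∂μ = ∫ z, ‖z‖ ^ 2 ∂μ + n - 2 * ∫ z, inner ℝ z (S z) ∂μ := by
    simp_rw [norm_sub_sq_real]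
    rw [integral_add h6 h3, integral_sub h1 (h4.const_mul 2),
      integral_const_mul, integral_norm_sq_of_map_eq_stdGaussian hS h]
    ring
  rw [← h5]
  refine ⟨integral_nonneg fun z => sq_nonneg _, ?_⟩
  rw [ofReal_integral_eq_lintegral_ofReal h7 (ae_of_all _ fun z => sq_nonneg _)]
  refine lintegral_congr fun z => ?_
  rw [← ofReal_norm, ENNReal.ofReal_pow (norm_nonneg _)]

end

/-! ### Extended-real integrals -/

/-- An integral of `p - q` whose positive part is finite is either `-∞` or an ordinary integral. -/
lemma extIntegral_sub_eq_bot_or {α : Type*} [MeasurableSpace α] (ν : Measure α)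
    {p q : α → ℝ≥0∞} (hp : Measurable p) (hq : Measurable q) (hpt : ∀ x, p x ≠ ⊤)
    (hpi : ∫⁻ x, p x ∂ν ≠ ⊤) :
    extIntegral ν (fun x => (p x : EReal) - (q x : EReal)) = ⊥ ∨
      (∀ᵐ x ∂ν, q x ≠ ⊤) ∧ Integrable (fun x => (p x).toReal - (q x).toReal) ν ∧
      extIntegral ν (fun x => (p x : EReal) - (q x : EReal)) =
        ((∫ x, (p x).toReal - (q x).toReal ∂ν : ℝ) : EReal) := by
  by_cases hqi : ∫⁻ x, q x ∂ν = ⊤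
  · left
    have hneg : ∀ x, (-((p x : EReal) - (q x : EReal))).toENNReal = q x - p x := fun x => by
      rw [EReal.neg_sub (Or.inl (EReal.coe_ennreal_ne_bot _))
        (Or.inl (by simpa using hpt x)), add_comm, ← sub_eq_add_neg,
        EReal.toENNReal_sub (EReal.coe_ennreal_nonneg _)]
      simp
    have h1 : ∫⁻ x, q x - p x ∂ν = ⊤ := by
      by_contra hcon
      have h2 : ∫⁻ x, q x ∂ν ≤ ∫⁻ x, q x - p x ∂ν + ∫⁻ x, p x ∂ν := by
        rw [← lintegral_add_right _ hp]
        exact lintegral_mono fun x => le_tsub_add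
      rw [hqi, top_le_iff, ENNReal.add_eq_top] at h2
      exact h2.elim hcon hpi
    simp_rw [extIntegral, hneg, h1]
    simp [sub_eq_add_neg]
  · right
    have hqt : ∀ᵐ x ∂ν, q x ≠ ⊤ := (ae_lt_top hq hqi).mono fun x hx => hx.ne
    have hint : Integrable (fun x => (p x).toReal - (q x).toReal) ν :=
      (integrable_toReal_of_lintegral_ne_top hp.aemeasurable hpi).sub
        (integrable_toReal_of_lintegral_ne_top hq.aemeasurable hqi)
    have hcoe : ∀ᵐ x ∂ν, (p x : EReal) - (q x : EReal) =
        (((p x).toReal - (q x).toReal : ℝ) : EReal) := by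
      filter_upwards [hqt] with x hx
      rw [EReal.coe_sub, EReal.coe_ennreal_toReal (hpt x), EReal.coe_ennreal_toReal hx]
    refine ⟨hqt, hint, ?_⟩
    rw [integral_eq_lintegral_pos_part_sub_lintegral_neg_part hint, extIntegral,
      EReal.coe_sub, EReal.coe_ennreal_toReal, EReal.coe_ennreal_toReal]
    · congr 2
      · refine lintegral_congr_ae (hcoe.mono fun x hx => ?_)
        simp only [hx, EReal.real_coe_toENNReal]
      · refine lintegral_congr_ae (hcoe.mono fun x hx => ?_)
        simp only [hx, ← EReal.coe_neg, EReal.real_coe_toENNReal]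
    · exact hint.neg.lintegral_lt_top.ne
    · exact hint.lintegral_lt_top.ne

/-! ### The conditional entropic Wasserstein bound -/

lemma entropyPower_rpow_eq {n : ℕ} (hn : 1 ≤ n) (H : ℝ) :
    2 * n * (ENNReal.ofReal (1 / (2 * Real.pi * Real.exp 1)) *
        EReal.exp (((2 / n : ℝ) : EReal) * (H : EReal))) ^ (1 / 2 : ℝ) =
      ENNReal.ofReal (2 * (n * Real.exp (H / n - Real.log (2 * Real.pi * Real.exp 1) / 2))) := by
  have hK : 0 < 2 * Real.pi * Real.exp 1 := by positivity
  have h1 : 1 / (2 * Real.pi * Real.exp 1) * Real.exp (2 / n * H) =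
      Real.exp ((H / n - Real.log (2 * Real.pi * Real.exp 1) / 2) * 2) := by
    rw [sub_mul, div_mul_cancel₀ _ two_ne_zero, Real.exp_sub, Real.exp_log hK]
    ring_nf
  rw [← EReal.coe_mul, EReal.exp_coe, ← ENNReal.ofReal_mul (by positivity), h1,
    ENNReal.ofReal_rpow_of_pos (Real.exp_pos _), ← Real.exp_mul, ← mul_assoc,
    ENNReal.ofReal_mul (by positivity), ENNReal.ofReal_mul (by positivity)]
  simp

theorem theoremT {𝒯 : Type*} [MeasurableSpace 𝒯] (n : ℕ) (hn : 1 ≤ n)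
    (PT : Measure 𝒯) [IsProbabilityMeasure PT]
    (PZ PY : Kernel 𝒯 (EuclideanSpace ℝ (Fin n))) [IsMarkovKernel PZ] [IsMarkovKernel PY]
    (hY : ∀ t, PY t = stdGaussian (EuclideanSpace ℝ (Fin n)))
    (hZ : ∀ t, PZ t ≪ stdGaussian (EuclideanSpace ℝ (Fin n)))
    (hZ2 : ∀ t, HasFiniteMoment 2 (PZ t))
    (hRHS : secondMoment PT PZ ≠ ⊤ ∨ condDiffEntropy PT PZ ≠ ⊤) :
    ((condWasserstein 2 PT PZ PY ^ 2 : ℝ≥0∞) : EReal) ≤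
      (secondMoment PT PZ : EReal) + (n : EReal)
        - ((2 * n * (ENNReal.ofReal (1 / (2 * Real.pi * Real.exp 1)) *
            EReal.exp (((2 / n : ℝ) : EReal) * condDiffEntropy PT PZ)) ^ (1 / 2 : ℝ) : ℝ≥0∞) :
            EReal) := by
  have hn0 : (0 : ℝ) < n := by exact_mod_cast hn
  by_cases hM : secondMoment PT PZ = ⊤
  · -- The right-hand side is infinite.
    have hh : condDiffEntropy PT PZ ≠ ⊤ := hRHS.resolve_left fun h => h hM
    have hexp : EReal.exp (((2 / n : ℝ) : EReal) * condDiffEntropy PT PZ) ≠ ⊤ := by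
      rw [Ne, EReal.exp_eq_top_iff]
      generalize condDiffEntropy PT PZ = h at hh
      induction h with
      | bot => rw [EReal.coe_mul_bot_of_pos (by positivity)]; simp
      | coe x => rw [← EReal.coe_mul]; exact EReal.coe_ne_top _
      | top => exact absurd rfl hh
    have hX : 2 * n * (ENNReal.ofReal (1 / (2 * Real.pi * Real.exp 1)) *
        EReal.exp (((2 / n : ℝ) : EReal) * condDiffEntropy PT PZ)) ^ (1 / 2 : ℝ) ≠ ⊤ :=
      ENNReal.mul_ne_top (by finiteness) (ENNReal.rpow_ne_top_of_nonneg (by norm_num)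
        (ENNReal.mul_ne_top ENNReal.ofReal_ne_top hexp))
    rw [hM, ← EReal.coe_ennreal_toReal hX, EReal.coe_ennreal_top,
      show (n : EReal) = ((n : ℝ) : EReal) from rfl, EReal.top_add_coe, EReal.top_sub_coe]
    exact le_top
  have hMem : ∀ t, MemLp (fun z => z) 2 (PZ t) := fun t => memLp_id_of_hasFiniteMoment (hZ2 t)
  have hvol : ∀ t, PZ t ≪ volume := fun t => absolutelyContinuous_volume_of_stdGaussian (hZ t)
  obtain ⟨S, r, D, hS, hr, hT⟩ := exists_isEntropicTransport_euclideanSpace n PZ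
  replace hT := fun t => hT t (hZ t) (hMem t)
  have hSt : ∀ t, Measurable fun z => S (t, z) := fun t => hS.comp measurable_prodMk_left
  have hrt : ∀ t, Measurable fun z => r (t, z) := fun t => hr.comp measurable_prodMk_left
  set m : 𝒯 → ℝ := fun t => ∫ z, ‖z‖ ^ 2 ∂(PZ t)
  set G : 𝒯 → ℝ := fun t => ∫ z, inner ℝ z (S (t, z)) ∂(PZ t)
  have hm0 : ∀ t, 0 ≤ m t := fun t => integral_nonneg fun z => sq_nonneg _
  have hG0 : ∀ t, 0 ≤ G t := fun t => (hT t).integral_nonneg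
  have hm : ∀ t, ∫⁻ z, ‖z‖ₑ ^ 2 ∂(PZ t) = ENNReal.ofReal (m t) := fun t => by
    rw [ofReal_integral_eq_lintegral_ofReal (hMem t).norm.integrable_sq
      (ae_of_all _ fun z => sq_nonneg _)]
    refine lintegral_congr fun z => ?_
    rw [← ofReal_norm, ENNReal.ofReal_pow (norm_nonneg _)]
  have hsec : secondMoment PT PZ = ∫⁻ t, ENNReal.ofReal (m t) ∂PT := by
    rw [secondMoment, Measure.lintegral_bind PZ.measurable.aemeasurable (by fun_prop)]
    simp_rw [hm]
  -- `m t` is the conditional second moment, `G t` the conditional mean of `⟨Z, S(t, Z)⟩`.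
  have hcost : ∀ t, 0 ≤ m t + n - 2 * G t ∧
      ∫⁻ z, ‖z - S (t, z)‖ₑ ^ 2 ∂(PZ t) = ENNReal.ofReal (m t + n - 2 * G t) := fun t =>
    lintegral_enorm_sub_sq_eq (hMem t) (hSt t) (hT t).map_eq
  have hmint : Integrable m PT := by
    refine ⟨(StronglyMeasurable.integral_kernel_prod_right' (κ := PZ)
      (f := fun p : 𝒯 × EuclideanSpace ℝ (Fin n) => ‖p.2‖ ^ 2)
      (by fun_prop)).aestronglyMeasurable, ?_⟩
    rw [hasFiniteIntegral_iff_ofReal (ae_of_all _ hm0), ← hsec]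
    exact lt_top_iff_ne_top.2 hM
  have hGint : Integrable G PT := by
    refine ((hmint.add (integrable_const (n : ℝ))).div_const 2).mono'
      (StronglyMeasurable.integral_kernel_prod_right' (κ := PZ)
        (f := fun p : 𝒯 × EuclideanSpace ℝ (Fin n) => inner ℝ p.2 (S p))
        (measurable_snd.inner hS).stronglyMeasurable).aestronglyMeasurable
      (ae_of_all _ fun t => ?_)
    have h1 := (hcost t).1
    rw [Real.norm_of_nonneg (hG0 t)]
    simp only [Pi.add_apply]
    linarith
  have hmn : Integrable (fun t => m t + n) PT := hmint.add (integrable_const _)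
  have hwint : Integrable (fun t => m t + n - 2 * G t) PT := hmn.sub (hGint.const_mul 2)
  have hwval : ∫ t, (m t + n - 2 * G t) ∂PT = ∫ t, m t ∂PT + n - 2 * ∫ t, G t ∂PT := by
    rw [integral_sub hmn (hGint.const_mul 2), integral_add hmint (integrable_const _),
      integral_const_mul]
    simp
  have hnonneg : 0 ≤ ∫ t, m t ∂PT + n - 2 * ∫ t, G t ∂PT := by
    rw [← hwval]
    exact integral_nonneg fun t => (hcost t).1
  have hW : condWasserstein 2 PT PZ PY ^ 2 ≤
      ENNReal.ofReal (∫ t, m t ∂PT + n - 2 * ∫ t, G t ∂PT) := by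
    refine (condWasserstein_sq_le PT PZ PY hS fun t => (hT t).map_eq.trans (hY t).symm).trans ?_
    rw [← hwval, ofReal_integral_eq_lintegral_ofReal hwint (ae_of_all _ fun t => (hcost t).1)]
    exact lintegral_mono fun t => (hcost t).2.le
  have hGbar : 0 ≤ ∫ t, G t ∂PT := integral_nonneg hG0
  obtain ⟨hpm, hqm⟩ := measurable_entropyPos_entropyNeg PZ hZ
  have hple : ∀ t, entropyPos (PZ t) ≤
      ENNReal.ofReal (n / 2 * Real.log (2 * Real.pi)) + ENNReal.ofReal (m t) + 1 := fun t => by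
    rw [← hm]
    exact entropyPos_le (PZ t) (hvol t)
  have hpt : ∀ t, entropyPos (PZ t) ≠ ⊤ := fun t => ne_top_of_le_ne_top (by finiteness) (hple t)
  have hpi : ∫⁻ t, entropyPos (PZ t) ∂PT ≠ ⊤ := by
    refine ne_top_of_le_ne_top ?_ (lintegral_mono hple)
    rw [lintegral_add_right _ measurable_const, lintegral_add_left measurable_const, ← hsec]
    simp [hM]
  have hent : condDiffEntropy PT PZ =
      extIntegral PT fun t => (entropyPos (PZ t) : EReal) - (entropyNeg (PZ t) : EReal) := by
    simp_rw [condDiffEntropy, diffEntropy_eq]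
  have hX : 2 * n * (ENNReal.ofReal (1 / (2 * Real.pi * Real.exp 1)) *
      EReal.exp (((2 / n : ℝ) : EReal) * condDiffEntropy PT PZ)) ^ (1 / 2 : ℝ) ≤
        ENNReal.ofReal (2 * ∫ t, G t ∂PT) := by
    rcases extIntegral_sub_eq_bot_or PT hpm hqm hpt hpi with hbot | ⟨hqt, hint, hval⟩
    · -- The entropy power vanishes.
      rw [hent, hbot, EReal.coe_mul_bot_of_pos (by positivity), EReal.exp_bot, mul_zero,
        ENNReal.zero_rpow_of_pos (by norm_num), mul_zero]
      exact zero_le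
    · rw [hent, hval, entropyPower_rpow_eq hn]
      refine ENNReal.ofReal_le_ofReal (mul_le_mul_of_nonneg_left ?_ zero_le_two)
      set H := ∫ t, ((entropyPos (PZ t)).toReal - (entropyNeg (PZ t)).toReal) ∂PT
      set K := Real.log (2 * Real.pi * Real.exp 1)
      -- This slope makes the averaged tangent-line bound equal to `n e^c`.
      set c := H / n - K / 2 with hc
      have hle : ∫ t, Real.exp c * (n * (1 - c) +
          ((entropyPos (PZ t)).toReal - (entropyNeg (PZ t)).toReal) - n / 2 * K) ∂PT ≤
            ∫ t, G t ∂PT := by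
        refine integral_mono_ae ?_ hGint ?_
        · exact ((((integrable_const _).add hint).sub (integrable_const _)).const_mul _)
        · filter_upwards [hqt] with t ht
          exact (hT t).exp_mul_le_integral (hSt t) (hrt t) (hpt t) ht c
      refine le_trans (le_of_eq ?_) hle
      have hcint : Integrable (fun t => n * (1 - c) +
          ((entropyPos (PZ t)).toReal - (entropyNeg (PZ t)).toReal)) PT :=
        (integrable_const _).add hint
      rw [integral_const_mul, integral_sub hcint (integrable_const _),
        integral_add (integrable_const _) hint]
      simp only [integral_const, probReal_univ, one_smul]
      have hnc : n * c = H - n / 2 * K := by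
        rw [hc]
        field_simp
      change n * Real.exp c = Real.exp c * (n * (1 - c) + H - n / 2 * K)
      linear_combination Real.exp c * hnc
  have hsec' : (secondMoment PT PZ : EReal) = ((∫ t, m t ∂PT : ℝ) : EReal) := by
    rw [hsec, ← ofReal_integral_eq_lintegral_ofReal hmint (ae_of_all _ hm0),
      EReal.coe_ennreal_ofReal, max_eq_left (integral_nonneg hm0)]
  calc ((condWasserstein 2 PT PZ PY ^ 2 : ℝ≥0∞) : EReal)
      ≤ ((ENNReal.ofReal (∫ t, m t ∂PT + n - 2 * ∫ t, G t ∂PT) : ℝ≥0∞) : EReal) :=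
        EReal.coe_ennreal_le_coe_ennreal_iff.2 hW
    _ = (secondMoment PT PZ : EReal) + (n : EReal) -
          ((ENNReal.ofReal (2 * ∫ t, G t ∂PT) : ℝ≥0∞) : EReal) := by
        rw [EReal.coe_ennreal_ofReal, max_eq_left hnonneg, EReal.coe_ennreal_ofReal,
          max_eq_left (by positivity), hsec', EReal.coe_sub, EReal.coe_add]
        rfl
    _ ≤ _ := EReal.sub_le_sub le_rfl (EReal.coe_ennreal_le_coe_ennreal_iff.2 hX)
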